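/- **Definitions.** A *Borel–Bratteli diagram* $B=(V,E)$ consists of at most countable vertex sets $V_n$ ($n\ge 0$), with $V_0=\{v_0\}$ a single point, at most countable edge sets $E_n$ ($n\ge 1$), and source and range maps $s:E_n\to V_{n-1}$, $r:E_n\to V_n$ such that $s^{-1}(v)\ne\emptyset$ for every vertex $v$, and $r^{-1}(v)$ is non-empty and finite for every $v\notin V_0$. Its path space $Y_B$ is the set of infinite paths $(e_1,e_2,\dots)$, $e_n\in E_n$, $s(e_{n+1})=r(e_n)$, with the topology generated by cylinder sets. $B$ is *ordered* if every $E_n$ carries a partial order in which two edges are comparable if and only if they have the same range, and no infinite path consists, from some level on, of maximal edges only or of minimal edges only. The *Vershik transformation* $\varphi:Y_B\to Y_B$ sends $(e_1,e_2,\dots)$ to $(f_1,\dots,f_{k-1},f_k,e_{k+1},\dots)$, where $k$ is least such that $e_k$ is not maximal, $f_k$ is the successor of $e_k$ in $r^{-1}(r(e_k))$, and $(f_1,\dots,f_{k-1})$ is the path of minimal edges from $v_0$ to $s(f_k)$. An ordered Borel–Bratteli diagram is *special* if, with the convention $V_{0,j}=\{v_0\}$ for all $j$, the following hold for all $n\ge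 1$. (i) $V_n$ is the disjoint union of sets $V_{n,j}$, $j\ge n$, with $2\le |V_{n,j}|<\infty$, and $V_{n,n}$ is the disjoint union of $V_{n,n}(0)$ and $V_{n,n}(1)$ with $|V_{n,n}(0)|\ge 2$. (ii) $E_n$ is the disjoint union of finite sets $E_{n,j}$, $j\ge n$. For $j>n$ one has $s(E_{n,j})=V_{n-1,j}$ and $r(E_{n,j})\subset V_{n,j}$. The set $E_{n,n}$ is the disjoint union of $E_{n,n}(0)$ and $E_{n,n}(1)$, where $V_{n-1,n-1}\subset s(E_{n,n}(0))\subset V_{n-1,n-1}\cup V_{n-1,n}$, $r(E_{n,n}(0))\subset V_{n,n}(0)$, $s(E_{n,n}(1))\subset V_{n-1,n}$, $r(E_{n,n}(1))\subset V_{n,n}(1)$ and $s(E_{n,n})=V_{n-1,n-1}\cup V_{n-1,n}$. Moreover $|r^{-1}(v)|=1$ if $v\in V_{n,j}$ with $j>n$ or $v\in V_{n,n}(1)$. If $v\in V_{n,n}(0)$, then $|r^{-1}(v)|\ge 4$, and the edges $e_1<\dots<e_m$ of $r^{-1}(v)$ satisfy $s(e_1)\in V_{n-1,n}$, $s(e_i)\in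 V_{n-1,n-1}$ for $1<i<m$, and $s(e_m)\in V_{n-1,n-1}(1)\cup\bigcup_{j>n-1}V_{n-1,j}$ (for $n=1$ the set $V_{0,0}(1)$ is to be ignored). Let $T$ be an aperiodic Borel automorphism of $X$. For $A\subset X$ and $k\ge 1$ let $C_k(A)$ be the set of $x\in A$ with $T^kx\in A$ and $T^ix\notin A$ for $0<i<k$. A *vanishing sequence of markers* for $T$ is a sequence of Borel sets $X=A_0\supset A_1\supset A_2\supset\cdots$ with $\bigcap_n A_n=\emptyset$ such that for every $n\ge1$: both $A_n$ and $X\setminus A_n$ meet every $T$-orbit; every $x\in A_n$ returns to $A_n$ under $T^m$ for infinitely many $m>0$ and for infinitely many $m<0$; $A_n\cap T^iA_n=\emptyset$ for $1\le i\le n-1$; and every non-empty $C_k(A_n)$, $k\ge1$, is uncountable. The set $A_n$ partitions $X$ into the $T$-towers $(T^iC_k(A_n))_{0\le i<k}$, $k\ge1$. **Theorem.** Let $X$ be a non-empty locally compact zero-dimensional Polish space (zero-dimensional: the clopen sets form a base) and let $T:X\to X$ be a homeomorphism without periodic points. Suppose that $T$ has a vanishing sequence of markers $(A_n)$ such that for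 all $n\ge1$ all the sets $T^iC_k(A_n)$, $0\le i<k$, of the associated tower partition are clopen. Then there exist a special (ordered) Borel–Bratteli diagram $B$, with Vershik transformation $\varphi$, and a homeomorphism $F:X\to Y_B$ such that $F\circ T=\varphi\circ F$. -/

import Mathlib

open Set Topology

/-! ### Borel–Bratteli diagrams -/

/-- A Borel–Bratteli diagram. `V n` is the set of vertices of level `n`, and `E n` is the set of
edges going from level `n` to level `n + 1` (usually written `E_{n+1}`). -/
structure BorelBratteli where
  V : ℕ → Type
  E : ℕ → Type
  s : ∀ n, E n → V n
  r : ∀ n, E n → V (n + 1)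
  v₀ : V 0
  eq_v₀ : ∀ v : V 0, v = v₀
  countable_V : ∀ n, Countable (V n)
  countable_E : ∀ n, Countable (E n)
  source_nonempty : ∀ n (v : V n), ∃ e, s n e = v
  range_nonempty : ∀ n (v : V (n + 1)), ∃ e, r n e = v
  range_finite : ∀ n (v : V (n + 1)), {e | r n e = v}.Finite

namespace BorelBratteli

/-- The space `Y_B` of infinite paths, which start at the top vertex. -/
def PathSpace (B : BorelBratteli) : Type :=
  {y : ∀ n, B.E n // ∀ n, B.s (n + 1) (y (n + 1)) = B.r n (y n)}

/-- The topology generated by the cylinder sets: the subspace topology inherited from the product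
of the discrete sets `E n`. -/
instance (B : BorelBratteli) : TopologicalSpace B.PathSpace :=
  TopologicalSpace.induced Subtype.val (@Pi.topologicalSpace ℕ B.E (fun _ => ⊥))

end BorelBratteli

/-- An ordered Borel–Bratteli diagram: each `E n` carries a partial order for which two edges are
comparable iff they have the same range, and no infinite path consists, from some level on, of
maximal edges only, or of minimal edges only. (As comparable edges have the same range, `IsMax e`
says that `e` is the largest element of the finite set `r⁻¹(r(e))`; same for `IsMin`.) -/
structure OrderedBorelBratteli extends BorelBratteli where
  order : ∀ n, PartialOrder (E n)
  comparable_iff : ∀ n (e f : E n), (e ≤ f ∨ f ≤ e) ↔ r n e = r n f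
  no_cofinal_max : ∀ y : toBorelBratteli.PathSpace, ¬ ∃ N, ∀ n, N ≤ n → IsMax (y.1 n)
  no_cofinal_min : ∀ y : toBorelBratteli.PathSpace, ¬ ∃ N, ∀ n, N ≤ n → IsMin (y.1 n)

namespace OrderedBorelBratteli

instance (B : OrderedBorelBratteli) (n : ℕ) : PartialOrder (B.E n) := B.order n

/-- `z` is the Vershik image of `y`: if `k` is the first level at which the edge of `y` is not
maximal, then `z` agrees with `y` after `k`, its edge at `k` is the successor of that of `y`, and
all its edges before `k` are minimal. -/
def IsVershikImage (B : OrderedBorelBratteli) (y z : B.PathSpace) : Prop :=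
  ∃ k, (∀ i, i < k → IsMax (y.1 i)) ∧ ¬ IsMax (y.1 k) ∧
    y.1 k ⋖ z.1 k ∧ (∀ i, k < i → z.1 i = y.1 i) ∧ (∀ i, i < k → IsMin (z.1 i))

theorem exists_min_edge (B : OrderedBorelBratteli) (n : ℕ) (v : B.V (n + 1)) :
    ∃ e : B.E n, B.r n e = v ∧ IsMin e := by
  obtain ⟨e, he⟩ := (B.range_finite n v).exists_minimal (B.range_nonempty n v)
  refine ⟨e, he.prop, fun f hf => he.le_of_le ?_ hf⟩
  exact ((B.comparable_iff n f e).1 (Or.inl hf)).trans he.prop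

theorem exists_succ_edge (B : OrderedBorelBratteli) (n : ℕ) (e : B.E n) (he : ¬ IsMax e) :
    ∃ f : B.E n, e ⋖ f := by
  obtain ⟨g, hg⟩ := not_isMax_iff.1 he
  have hfin : {f : B.E n | e < f}.Finite := (B.range_finite n (B.r n e)).subset
    fun f hf => ((B.comparable_iff n f e).1 (Or.inr (le_of_lt hf)))
  obtain ⟨f, hf⟩ := hfin.exists_minimal ⟨g, hg⟩
  exact ⟨f, hf.prop, fun c hec hcf => (not_le_of_gt hcf) (hf.le_of_le hec hcf.le)⟩

theorem exists_min_extension (B : OrderedBorelBratteli) (k : ℕ) :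
    ∀ y : ∀ n, B.E n, (∀ n, k ≤ n → B.s (n + 1) (y (n + 1)) = B.r n (y n)) →
      ∃ z : B.PathSpace, (∀ i, k ≤ i → z.1 i = y i) ∧ ∀ i, i < k → IsMin (z.1 i) := by
  induction k with
  | zero => exact fun y hy => ⟨⟨y, fun n => hy n (Nat.zero_le n)⟩, fun _ _ => rfl, by simp⟩
  | succ k ih =>
    intro y hy
    obtain ⟨g, hg, hmin⟩ := B.exists_min_edge k (B.s (k + 1) (y (k + 1)))
    obtain ⟨z, hz, hz'⟩ := ih (Function.update y k g) (by
      intro n hn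
      rw [Function.update_of_ne (by omega)]
      rcases hn.eq_or_lt with rfl | hn
      · simp [hg]
      · rw [Function.update_of_ne (by omega)]
        exact hy n hn)
    refine ⟨z, fun i hi => ?_, fun i hi => ?_⟩
    · rw [hz i (by omega), Function.update_of_ne (by omega)]
    · rcases (Nat.lt_succ_iff.1 hi).eq_or_lt with rfl | h
      · rw [hz i le_rfl, Function.update_self]
        exact hmin
      · exact hz' i h

theorem exists_isVershikImage (B : OrderedBorelBratteli) (y : B.PathSpace) :
    ∃ z, B.IsVershikImage y z := by
  classical
  have hex : ∃ k, ¬ IsMax (y.1 k) := by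
    by_contra h
    push Not at h
    exact B.no_cofinal_max y ⟨0, fun n _ => h n⟩
  set k := Nat.find hex with hk
  have hkm : ¬ IsMax (y.1 k) := Nat.find_spec hex
  obtain ⟨f, hf⟩ := B.exists_succ_edge k (y.1 k) hkm
  obtain ⟨z, hz, hz'⟩ := B.exists_min_extension k (Function.update y.1 k f) (by
    intro n hn
    rw [Function.update_of_ne (by omega), y.2 n]
    rcases hn.eq_or_lt with h | hn
    · rw [← h, Function.update_self]
      exact (B.comparable_iff k _ _).1 (Or.inl hf.le)
    · rw [Function.update_of_ne (by omega)])
  refine ⟨z, k, fun i hi => not_not.1 (Nat.find_min hex hi), hkm, ?_, fun i hi => ?_, hz'⟩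
  · rw [hz k le_rfl, Function.update_self]
    exact hf
  · rw [hz i hi.le, Function.update_of_ne (by omega)]

theorem IsVershikImage.unique (B : OrderedBorelBratteli) {y z z' : B.PathSpace}
    (h : B.IsVershikImage y z) (h' : B.IsVershikImage y z') : z = z' := by
  obtain ⟨k, h1, h2, h3, h4, h5⟩ := h
  obtain ⟨l, g1, g2, g3, g4, g5⟩ := h'
  obtain rfl : k = l := by
    rcases lt_trichotomy k l with hlt | heq | hlt
    · exact absurd (g1 k hlt) h2
    · exact heq
    · exact absurd (h1 l hlt) g2
  have hk : z.1 k = z'.1 k := by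
    have hr : B.r k (z.1 k) = B.r k (z'.1 k) :=
      ((B.comparable_iff k _ _).1 (Or.inr h3.le)).trans ((B.comparable_iff k _ _).1 (Or.inl g3.le))
    rcases (B.comparable_iff k _ _).2 hr with h | h
    · exact h.eq_or_lt.resolve_right (g3.2 h3.1)
    · exact (h.eq_or_lt.resolve_right (h3.2 g3.1)).symm
  have hlow : ∀ d i, i + d = k → z.1 i = z'.1 i := by
    intro d
    induction d with
    | zero => rintro i rfl; exact hk
    | succ d ih =>
      intro i hi
      have hr : B.r i (z.1 i) = B.r i (z'.1 i) := by
        rw [← z.2 i, ← z'.2 i, ih (i + 1) (by omega)]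
      rcases (B.comparable_iff i _ _).2 hr with h | h
      · exact le_antisymm h (g5 i (by omega) h)
      · exact le_antisymm (h5 i (by omega) h) h
  refine Subtype.ext (funext fun i => ?_)
  rcases le_or_gt i k with hi | hi
  · exact hlow (k - i) i (by omega)
  · rw [h4 i hi, g4 i hi]

/-- The Vershik transformation of the path space of an ordered Borel–Bratteli diagram. -/
noncomputable def vershik (B : OrderedBorelBratteli) (y : B.PathSpace) : B.PathSpace :=
  Classical.choose (B.exists_isVershikImage y)

theorem isVershikImage_vershik (B : OrderedBorelBratteli) (y : B.PathSpace) :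
    B.IsVershikImage y (B.vershik y) :=
  Classical.choose_spec (B.exists_isVershikImage y)

/-! ### Special Borel–Bratteli diagrams -/

/-- The data exhibiting an ordered Borel–Bratteli diagram as a special one.

* `VC n j`, for `j ≥ n`, is the set `V_{nj}`; on level `0` all of them are `{v₀}`.
* `VC0 n` and `VC1 n`, for `n ≥ 1`, are the sets `V_{nn}(0)` and `V_{nn}(1)`.
* `EC n j`, for `j ≥ n + 1`, is the set `E_{n+1,j}` of edges from level `n` to level `n + 1`.
* `EC0 n` and `EC1 n` are the sets `E_{n+1,n+1}(0)` and `E_{n+1,n+1}(1)`. -/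
structure SpecialStructure (B : OrderedBorelBratteli) where
  VC : ∀ n, ℕ → Set (B.V n)
  VC0 : ∀ n, Set (B.V n)
  VC1 : ∀ n, Set (B.V n)
  EC : ∀ n, ℕ → Set (B.E n)
  EC0 : ∀ n, Set (B.E n)
  EC1 : ∀ n, Set (B.E n)
  VC_zero : ∀ j, VC 0 j = {B.v₀}
  -- the partition of the vertices
  VC_cover : ∀ n, 1 ≤ n → ∀ v : B.V n, ∃ j, n ≤ j ∧ v ∈ VC n j
  VC_disjoint : ∀ n, 1 ≤ n → ∀ j j', n ≤ j → n ≤ j' → j ≠ j' → Disjoint (VC n j) (VC n j')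
  VC_finite : ∀ n, 1 ≤ n → ∀ j, n ≤ j → (VC n j).Finite
  VC_two_le : ∀ n, 1 ≤ n → ∀ j, n ≤ j → 2 ≤ (VC n j).ncard
  VC_diag : ∀ n, 1 ≤ n → VC n n = VC0 n ∪ VC1 n
  VC_diag_disjoint : ∀ n, 1 ≤ n → Disjoint (VC0 n) (VC1 n)
  VC0_two_le : ∀ n, 1 ≤ n → 2 ≤ (VC0 n).ncard
  -- the partition of the edges
  EC_cover : ∀ n (e : B.E n), ∃ j, n + 1 ≤ j ∧ e ∈ EC n j
  EC_disjoint : ∀ n j j', n + 1 ≤ j → n + 1 ≤ j' → j ≠ j' → Disjoint (EC n j) (EC n j')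
  EC_finite : ∀ n j, n + 1 ≤ j → (EC n j).Finite
  EC_source : ∀ n j, n + 1 < j → B.s n '' EC n j = VC n j
  EC_range : ∀ n j, n + 1 < j → ∀ e ∈ EC n j, B.r n e ∈ VC (n + 1) j
  EC_diag : ∀ n, EC n (n + 1) = EC0 n ∪ EC1 n
  EC_diag_disjoint : ∀ n, Disjoint (EC0 n) (EC1 n)
  EC_diag_source : ∀ n, B.s n '' EC n (n + 1) = VC n n ∪ VC n (n + 1)
  EC0_source : ∀ n, ∀ e ∈ EC0 n, B.s n e ∈ VC n n ∪ VC n (n + 1)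
  subset_EC0_source : ∀ n, VC n n ⊆ B.s n '' EC0 n
  EC0_range : ∀ n, ∀ e ∈ EC0 n, B.r n e ∈ VC0 (n + 1)
  EC1_source : ∀ n, ∀ e ∈ EC1 n, B.s n e ∈ VC n (n + 1)
  EC1_range : ∀ n, ∀ e ∈ EC1 n, B.r n e ∈ VC1 (n + 1)
  -- the number of edges arriving at a vertex
  card_range : ∀ n j, n + 1 < j → ∀ v ∈ VC (n + 1) j, {e | B.r n e = v}.ncard = 1
  card_range_one : ∀ n, ∀ v ∈ VC1 (n + 1), {e | B.r n e = v}.ncard = 1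
  card_range_zero : ∀ n, ∀ v ∈ VC0 (n + 1), 4 ≤ {e | B.r n e = v}.ncard
  -- the order `e₁ < ⋯ < eₘ` on the edges arriving at a vertex of `V_{n+1,n+1}(0)`
  source_min : ∀ n (e : B.E n), B.r n e ∈ VC0 (n + 1) → IsMin e → B.s n e ∈ VC n (n + 1)
  source_mid : ∀ n (e : B.E n), B.r n e ∈ VC0 (n + 1) → ¬ IsMin e → ¬ IsMax e →
    B.s n e ∈ VC n n
  source_max : ∀ n (e : B.E n), B.r n e ∈ VC0 (n + 1) → IsMax e →
    B.s n e ∈ VC1 n ∨ ∃ j, n < j ∧ B.s n e ∈ VC n j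

/-- An ordered Borel–Bratteli diagram is special if it admits a special structure. -/
def IsSpecial (B : OrderedBorelBratteli) : Prop := Nonempty B.SpecialStructure

end OrderedBorelBratteli

/-! ### Aperiodic homeomorphisms and vanishing sequences of markers -/

section Markers

variable {X : Type*} [TopologicalSpace X]

/-- `T` has no periodic points. -/
def IsAperiodic (T : X ≃ₜ X) : Prop := ∀ x, ∀ n : ℕ, 0 < n → (T ^ n) x ≠ x

/-- Every `T`-orbit meets `A`. -/
def IsCompleteSection (T : X ≃ₜ X) (A : Set X) : Prop := ∀ x, ∃ k : ℤ, (T ^ k) x ∈ A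

/-- The set `C_k` of points of `A` whose first return time to `A` is `k` (for `k ≥ 1`). -/
def towerBase (T : X ≃ₜ X) (A : Set X) (k : ℕ) : Set X :=
  {x | x ∈ A ∧ (T ^ k) x ∈ A ∧ ∀ i : ℕ, 0 < i → i < k → (T ^ i) x ∉ A}

/-- Vanishing sequences of markers. -/
structure IsVanishingMarkers [MeasurableSpace X] (T : X ≃ₜ X) (A : ℕ → Set X) : Prop where
  measurable : ∀ n, MeasurableSet (A n)
  zero : A 0 = univ
  antitone : ∀ n, A (n + 1) ⊆ A n
  inter : ⋂ n, A n = ∅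
  section_self : ∀ n, 1 ≤ n → IsCompleteSection T (A n)
  section_compl : ∀ n, 1 ≤ n → IsCompleteSection T (A n)ᶜ
  recurrent_pos : ∀ n, 1 ≤ n → ∀ x ∈ A n, {m : ℕ | (T ^ m) x ∈ A n}.Infinite
  recurrent_neg : ∀ n, 1 ≤ n → ∀ x ∈ A n, {m : ℕ | (T⁻¹ ^ m) x ∈ A n}.Infinite
  separated : ∀ n, 1 ≤ n → ∀ i, 1 ≤ i → i < n → A n ∩ (T ^ i) '' A n = ∅
  uncountable : ∀ n, 1 ≤ n → ∀ k, 1 ≤ k → (towerBase T (A n) k).Nonempty →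
    ¬ (towerBase T (A n) k).Countable

/-- For each `n ≥ 1`, all atoms `T^i C_k`, `0 ≤ i < k`, of the partition of `X` into the `T`-towers
built over the marker set `A n` are clopen. -/
def HasClopenTowers (T : X ≃ₜ X) (A : ℕ → Set X) : Prop :=
  ∀ n, 1 ≤ n → ∀ k i : ℕ, i < k → IsClopen ((T ^ i) '' towerBase T (A n) k)

end Markers

/-!
Only two consequences of the markers matter: every orbit leaves every compact set in both
directions of time (by compactness, a compact set misses some `A n`, which every orbit visits), and
`X` is not discrete. Hence the markers may be replaced by the complements of an exhaustion of `X` by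
compact open sets `C n`, encoded by a level function `lev` with `C n = {x | lev x < n}`. The
exhaustion is chosen so that the level changes by at most one along an orbit and pauses for three
steps before each rise; this gives the towers over `{x | n ≤ lev x}` height one or at least four and
sorts them into the classes of a special diagram.

Label the points at stage `n` by their level and by their positions relative to the first `n` of
countably many compact open sets forming a base. The word of a tower of level `n` is the sequence of
labels of its points. The vertices of level `n` are the words of the towers of level `n`, and the
edges record how a tower of level `n + 1` is cut into towers of level `n`. A point follows the
edges describing its position in its successive towers. Moving it one step up its towers is the
Vershik transformation, points with the same path lie in the same basic sets, and compactness of the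
sublevel sets turns each infinite path into a point. An additional label splits the towers of height
at least four at each level, so that no vertex class is a singleton.
-/

/-! ### Return times -/

theorem iterate_iterate_of_leftInverse {α : Type*} {f g : α → α} (h : Function.LeftInverse g f)
    {m k : ℕ} (hmk : m ≤ k) (x : α) : g^[m] (f^[k] x) = f^[k - m] x := by
  obtain ⟨d, rfl⟩ := Nat.exists_eq_add_of_le hmk
  rw [Function.iterate_add_apply, Nat.add_sub_cancel_left, h.iterate m]

/-- A nested family of sets `{x | n ≤ lev x}`, encoded by a function `lev`, each of which is visited
by every forward and every backward orbit of `T`. They take over the role of the markers. -/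
structure LevelFunction {X : Type*} (T : X ≃ X) where
  lev : X → ℕ
  forward : ∀ n x, ∃ i, n ≤ lev (T^[i] x)
  backward : ∀ n x, ∃ i, n ≤ lev (T.symm^[i] x)

namespace LevelFunction

section ReturnTimes

variable {X : Type*} {T : X ≃ X} (L : LevelFunction T)

/-- The time elapsed since the last visit to `{x | n ≤ lev x}`: the height of `x` in its tower of
level `n`. -/
def back (n : ℕ) (x : X) : ℕ := Nat.find (L.backward n x)

/-- The point at the bottom of the tower of level `n`, below `x`. -/
def base (n : ℕ) (x : X) : X := T.symm^[L.back n x] x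

/-- The first return time to `{x | n ≤ lev x}`: the height of the tower of level `n` over `x`. -/
def ret (n : ℕ) (x : X) : ℕ := Nat.find (L.forward n (T x)) + 1

variable {L} {n i k : ℕ} {x y w : X}

theorem le_lev_base : n ≤ L.lev (L.base n x) := Nat.find_spec (L.backward n x)

theorem base_eq_iterate_sub (h : i ≤ L.back n x) : T^[i] (L.base n x) = T.symm^[L.back n x - i] x :=
  iterate_iterate_of_leftInverse T.rightInverse_symm h x

@[simp]
theorem iterate_back_base : T^[L.back n x] (L.base n x) = x := by
  simp [base_eq_iterate_sub le_rfl]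

theorem lev_iterate_base_lt (hi : 0 < i) (hib : i ≤ L.back n x) :
    L.lev (T^[i] (L.base n x)) < n := by
  rw [base_eq_iterate_sub hib]
  exact not_le.1 (Nat.find_min (L.backward n x) (Nat.sub_lt (hi.trans_le hib) hi))

theorem back_iterate (hx : n ≤ L.lev x) (hk : ∀ i, 0 < i → i ≤ k → L.lev (T^[i] x) < n) :
    L.back n (T^[k] x) = k := by
  rw [back, Nat.find_eq_iff]
  constructor
  · simpa [iterate_iterate_of_leftInverse T.leftInverse_symm le_rfl] using hx
  · intro m hm
    rw [iterate_iterate_of_leftInverse T.leftInverse_symm hm.le, not_le]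
    exact hk _ (by omega) (by omega)

theorem base_iterate (hx : n ≤ L.lev x) (hk : ∀ i, 0 < i → i ≤ k → L.lev (T^[i] x) < n) :
    L.base n (T^[k] x) = x := by
  simp [base, back_iterate hx hk, iterate_iterate_of_leftInverse T.leftInverse_symm le_rfl]

theorem back_eq_zero_iff : L.back n x = 0 ↔ n ≤ L.lev x := Nat.find_eq_zero _

theorem back_pos_iff : 0 < L.back n x ↔ L.lev x < n := by
  rw [Nat.pos_iff_ne_zero, ne_eq, back_eq_zero_iff, not_le]

theorem base_eq_self (hx : n ≤ L.lev x) : L.base n x = x := by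
  simp [base, back_eq_zero_iff.2 hx]

theorem lev_map_base_lt (hx : L.lev x < n) : L.lev (T (L.base n x)) < n :=
  lev_iterate_base_lt (i := 1) one_pos (back_pos_iff.2 hx)

theorem ret_pos : 0 < L.ret n x := Nat.succ_pos _

theorem le_lev_iterate_ret : n ≤ L.lev (T^[L.ret n x] x) := Nat.find_spec (L.forward n (T x))

theorem lev_iterate_lt_of_lt_ret (hi : 0 < i) (hir : i < L.ret n x) : L.lev (T^[i] x) < n := by
  obtain ⟨i, rfl⟩ := Nat.exists_eq_add_one.2 hi
  exact not_le.1 (Nat.find_min (L.forward n (T x)) (Nat.lt_of_succ_lt_succ hir))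

theorem ret_le (hk : 0 < k) (hkx : n ≤ L.lev (T^[k] x)) : L.ret n x ≤ k := by
  by_contra! h
  exact (lev_iterate_lt_of_lt_ret hk h).not_ge hkx

theorem ret_eq_of_forall (hk : 0 < k) (hkx : n ≤ L.lev (T^[k] x))
    (h : ∀ i, 0 < i → i < k → L.lev (T^[i] x) < n) : L.ret n x = k := by
  refine (ret_le hk hkx).antisymm (not_lt.1 fun hlt => ?_)
  exact (h _ ret_pos hlt).not_ge le_lev_iterate_ret

theorem ret_eq_one_iff : L.ret n x = 1 ↔ n ≤ L.lev (T x) := by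
  rw [ret, Nat.add_eq_right, Nat.find_eq_zero]
  rfl

theorem back_lt_ret : L.back n x < L.ret n (L.base n x) := by
  by_contra! h
  exact (lev_iterate_base_lt ret_pos h).not_ge le_lev_iterate_ret

theorem back_iterate_of_lt (hx : n ≤ L.lev x) (hk : k < L.ret n x) : L.back n (T^[k] x) = k :=
  back_iterate hx fun _ hi hik => lev_iterate_lt_of_lt_ret hi (hik.trans_lt hk)

theorem base_iterate_of_lt (hx : n ≤ L.lev x) (hk : k < L.ret n x) : L.base n (T^[k] x) = x :=
  base_iterate hx fun _ hi hik => lev_iterate_lt_of_lt_ret hi (hik.trans_lt hk)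

theorem back_map (hx : L.lev (T x) < n) : L.back n (T x) = L.back n x + 1 := by
  have hT : T^[L.back n x + 1] (L.base n x) = T x := by
    rw [Function.iterate_succ_apply', iterate_back_base]
  have h : L.back n (T^[L.back n x + 1] (L.base n x)) = L.back n x + 1 := by
    refine back_iterate le_lev_base fun i hi hi' => ?_
    rcases hi'.lt_or_eq with hi' | rfl
    · exact lev_iterate_base_lt hi (Nat.lt_succ_iff.1 hi')
    · rwa [hT]
  rwa [hT] at h

theorem base_map (hx : L.lev (T x) < n) : L.base n (T x) = L.base n x := by
  rw [base, back_map hx, Function.iterate_succ_apply, T.symm_apply_apply, base]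

theorem ret_congr
    (h : ∀ i, 0 < i → i ≤ L.ret n x → (n ≤ L.lev (T^[i] x) ↔ n ≤ L.lev (T^[i] y))) :
    L.ret n x = L.ret n y := by
  refine (ret_eq_of_forall ret_pos ((h _ ret_pos le_rfl).1 le_lev_iterate_ret) ?_).symm
  intro i hi hir
  have := lev_iterate_lt_of_lt_ret hi hir
  rwa [← not_le, h i hi hir.le, not_le] at this

theorem back_congr
    (h : ∀ i ≤ L.back n x, (n ≤ L.lev (T.symm^[i] x) ↔ n ≤ L.lev (T.symm^[i] y))) :
    L.back n x = L.back n y :=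
  Nat.find_congr (x := L.back n x) le_lev_base h

theorem back_le_back_succ : L.back n x ≤ L.back (n + 1) x :=
  Nat.find_min' _ ((Nat.le_succ n).trans le_lev_base)

theorem base_eq_iterate_base_succ :
    L.base n x = T^[L.back (n + 1) x - L.back n x] (L.base (n + 1) x) := by
  rw [base_eq_iterate_sub (Nat.sub_le _ _), Nat.sub_sub_self back_le_back_succ, base]

theorem back_succ_base : L.back (n + 1) (L.base n x) = L.back (n + 1) x - L.back n x := by
  rw [base_eq_iterate_base_succ]
  exact back_iterate_of_lt le_lev_base ((Nat.sub_le _ _).trans_lt back_lt_ret)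

theorem base_succ_base : L.base (n + 1) (L.base n x) = L.base (n + 1) x := by
  rw [base_eq_iterate_base_succ (n := n)]
  exact base_iterate_of_lt le_lev_base ((Nat.sub_le _ _).trans_lt back_lt_ret)

theorem ret_iterate_le (hk : k < L.ret (n + 1) x) : L.ret n (T^[k] x) ≤ L.ret (n + 1) x - k := by
  refine ret_le (Nat.sub_pos_of_lt hk) ?_
  rw [← Function.iterate_add_apply, Nat.sub_add_cancel hk.le]
  exact (Nat.le_succ n).trans le_lev_iterate_ret

theorem le_back_succ_base (hk : n ≤ L.lev (T^[k] (L.base (n + 1) x)))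
    (hkx : k ≤ L.back (n + 1) x) : k ≤ L.back (n + 1) (L.base n x) := by
  rw [base_eq_iterate_sub hkx] at hk
  have : L.back n x ≤ L.back (n + 1) x - k := Nat.find_min' _ hk
  rw [back_succ_base]
  omega

variable (L) in
/-- The bases of the towers of level `n` and height at least two. -/
def tallBase (n : ℕ) : Set X := {x | n ≤ L.lev x ∧ L.lev (T x) < n}

variable (L) in
/-- The points of level exactly `n` over which the tower of level `n` has height one. -/
def flatBase (n : ℕ) : Set X := {x | L.lev x = n ∧ n ≤ L.lev (T x)}

theorem base_mem_tallBase (hx : L.lev x < n) : L.base n x ∈ L.tallBase n :=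
  ⟨le_lev_base, lev_map_base_lt hx⟩

theorem infinite_tallBase (h : {x | L.lev x < n}.Infinite) : (L.tallBase n).Infinite := by
  refine fun hfin => h ?_
  have hcover : {x | L.lev x < n} ⊆
      ⋃ w ∈ L.tallBase n, (fun k => T^[k] w) '' Set.Iio (L.ret n w) := fun x hx =>
    mem_biUnion (base_mem_tallBase hx) ⟨L.back n x, back_lt_ret, iterate_back_base⟩
  exact (hfin.biUnion fun w _ => (Set.finite_Iio _).image _).subset hcover

variable (L) in
/-- The levels rise along orbits only by steps of one, each preceded by three points of the same
level, and fall by steps of at most one. The pause before each rise makes the towers of height at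
least two at least four points high. -/
structure IsGradual : Prop where
  lev_le : ∀ x, L.lev x ≤ L.lev (T x) + 1
  map_eq_of_lt : ∀ x, L.lev x < L.lev (T x) → L.lev (T x) = L.lev x + 1
  symm_iterate_eq_of_lt : ∀ x, L.lev x < L.lev (T x) → ∀ i < 3, L.lev (T.symm^[i] x) = L.lev x

namespace IsGradual

variable (hL : L.IsGradual)
include hL

theorem lev_eq (hw : w ∈ L.tallBase n) : L.lev w = n :=
  le_antisymm ((hL.lev_le w).trans hw.2) hw.1

theorem lev_base (hx : L.lev x < n) : L.lev (L.base n x) = n := hL.lev_eq (base_mem_tallBase hx)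

theorem lev_iterate_ret_pred (hw : L.lev (T w) < n) :
    L.lev (T^[L.ret n w - 1] w) + 1 = n ∧ L.lev (T^[L.ret n w] w) = n := by
  have hne : L.ret n w ≠ 1 := by rw [ne_eq, ret_eq_one_iff, not_le]; exact hw
  have hpos : 0 < L.ret n w := ret_pos
  have hlt : L.lev (T^[L.ret n w - 1] w) < n := lev_iterate_lt_of_lt_ret (by omega) (by omega)
  have hle : n ≤ L.lev (T^[L.ret n w] w) := le_lev_iterate_ret
  have hT : T (T^[L.ret n w - 1] w) = T^[L.ret n w] w := by
    rw [← Function.iterate_succ_apply' T, Nat.succ_eq_add_one, Nat.sub_add_cancel hpos]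
  have := hL.map_eq_of_lt _ (hT ▸ hlt.trans_le hle)
  rw [hT] at this
  omega

theorem lev_iterate_ret_sub (hw : L.lev (T w) < n) (hi : 1 ≤ i) (hi3 : i ≤ 3)
    (hir : i ≤ L.ret n w) : L.lev (T^[L.ret n w - i] w) + 1 = n := by
  obtain ⟨hlast, hret⟩ := hL.lev_iterate_ret_pred hw
  set z := T^[L.ret n w - 1] w with hz
  have hT : T z = T^[L.ret n w] w := by
    rw [hz, ← Function.iterate_succ_apply' T, Nat.succ_eq_add_one, Nat.sub_add_cancel ret_pos]
  have hsymm : T.symm^[i - 1] z = T^[L.ret n w - i] w := by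
    rw [hz, iterate_iterate_of_leftInverse T.leftInverse_symm (by omega),
      show L.ret n w - 1 - (i - 1) = L.ret n w - i by omega]
  rw [← hsymm, hL.symm_iterate_eq_of_lt z (by rw [hT]; omega) _ (by omega), hlast]

theorem four_le_ret (hw : w ∈ L.tallBase n) : 4 ≤ L.ret n w := by
  by_contra! h
  have := hL.lev_iterate_ret_sub hw.2 ret_pos (by omega) le_rfl
  rw [Nat.sub_self, Function.iterate_zero_apply, hL.lev_eq hw] at this
  omega

end IsGradual

end ReturnTimes

end LevelFunction

/-! ### The diagram of a marked level function -/

/-- A level function together with countably many two-valued labels. -/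
structure MarkedLevelFunction {X : Type*} (T : X ≃ X) extends LevelFunction T where
  mark : ℕ → X → Bool

namespace MarkedLevelFunction

section Diagram

open LevelFunction

variable {X : Type*} {T : X ≃ X} (L : MarkedLevelFunction T)

/-- The label of a point at level `n`: its level and its first `n` marks. Encoding it as a list of
length `n` makes it trivial for `n = 0`, so that there is only one vertex of level `0`. -/
def code (n : ℕ) (x : X) : List (ℕ × Bool) := (List.range n).map fun i => (L.lev x, L.mark i x)

/-- The labels read along the orbit of `x` up to the first return to `{x | n ≤ lev x}`. -/
def word (n : ℕ) (x : X) : List (List (ℕ × Bool)) :=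
  (List.range (L.ret n x)).map fun i => L.code n (T^[i] x)

/-- The labels read along the whole tower of level `n` through `x`. -/
def towerWord (n : ℕ) (x : X) : List (List (ℕ × Bool)) := L.word n (L.base n x)

/-- The vertices of level `n` are the words read along the towers of level `n`. -/
def Vert (n : ℕ) : Type := range (L.towerWord n)

/-- The tower of level `n` through `x`, as a vertex. -/
def toVert (n : ℕ) (x : X) : L.Vert n := ⟨L.towerWord n x, mem_range_self x⟩

/-- The edges from level `n` to level `n + 1` record the heights at which the orbit segments of a
tower of level `n + 1` visit `{x | n ≤ lev x}`. -/
def Edge (n : ℕ) : Type := (fun x => (L.towerWord (n + 1) x, L.back (n + 1) x)) '' {x | n ≤ L.lev x}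

variable {L} {n i k : ℕ} {x y w : X}

theorem code_eq_iff :
    L.code n x = L.code n y ↔ ∀ i < n, L.lev x = L.lev y ∧ L.mark i x = L.mark i y := by
  simp [code]

theorem code_eq_of_code_succ (h : L.code (n + 1) x = L.code (n + 1) y) :
    L.code n x = L.code n y :=
  code_eq_iff.2 fun i hi => code_eq_iff.1 h i (hi.trans (Nat.lt_succ_self n))

theorem lev_eq_of_code_eq (hn : 0 < n) (h : L.code n x = L.code n y) : L.lev x = L.lev y :=
  (code_eq_iff.1 h 0 hn).1

theorem word_eq_iff : L.word n x = L.word n y ↔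
    L.ret n x = L.ret n y ∧ ∀ i < L.ret n x, L.code n (T^[i] x) = L.code n (T^[i] y) := by
  constructor
  · intro h
    have hret : L.ret n x = L.ret n y := by simpa [word] using congrArg List.length h
    refine ⟨hret, ?_⟩
    simpa [word, hret] using h
  · rintro ⟨hret, h⟩
    simpa [word, hret] using h

theorem towerWord_of_le (hx : n ≤ L.lev x) : L.towerWord n x = L.word n x := by
  rw [towerWord, base_eq_self hx]

theorem towerWord_base : L.towerWord n (L.base n x) = L.towerWord n x :=
  towerWord_of_le le_lev_base

theorem towerWord_succ_base : L.towerWord (n + 1) (L.base n x) = L.towerWord (n + 1) x := by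
  rw [towerWord, base_succ_base, towerWord]

theorem towerWord_map (hx : L.lev (T x) < n) : L.towerWord n (T x) = L.towerWord n x := by
  rw [towerWord, base_map hx, towerWord]

theorem towerWord_zero : L.towerWord 0 x = L.towerWord 0 y := by
  have hret (z : X) : L.ret 0 z = 1 := ret_eq_one_iff.2 (Nat.zero_le _)
  simp [towerWord, word_eq_iff, hret, code]

theorem code_eq_of_towerWord_eq (h : L.towerWord n x = L.towerWord n y)
    (hb : L.back n x = L.back n y) : L.code n x = L.code n y := by
  have := (word_eq_iff.1 h).2 _ back_lt_ret
  rwa [iterate_back_base, hb, iterate_back_base] at this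

theorem le_lev_iterate_iff_of_word_eq (h : L.word (n + 1) x = L.word (n + 1) y)
    (hi : i ≤ L.ret (n + 1) x) : n ≤ L.lev (T^[i] x) ↔ n ≤ L.lev (T^[i] y) := by
  obtain ⟨hret, hcode⟩ := word_eq_iff.1 h
  rcases hi.lt_or_eq with hi | rfl
  · rw [lev_eq_of_code_eq (Nat.succ_pos n) (hcode i hi)]
  · refine iff_of_true ((Nat.le_succ n).trans le_lev_iterate_ret) ?_
    rw [hret]
    exact (Nat.le_succ n).trans le_lev_iterate_ret

theorem word_iterate_eq (h : L.word (n + 1) x = L.word (n + 1) y) (hk : k < L.ret (n + 1) x) :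
    L.word n (T^[k] x) = L.word n (T^[k] y) := by
  have hle : L.ret n (T^[k] x) ≤ L.ret (n + 1) x - k := ret_iterate_le hk
  refine word_eq_iff.2 ⟨ret_congr fun i _ hi => ?_, fun i hi => ?_⟩ <;>
    simp only [← Function.iterate_add_apply]
  · exact le_lev_iterate_iff_of_word_eq h (by omega)
  · exact code_eq_of_code_succ ((word_eq_iff.1 h).2 _ (by omega))

theorem back_eq_of_towerWord_succ_eq (h : L.towerWord (n + 1) x = L.towerWord (n + 1) y)
    (hb : L.back (n + 1) x = L.back (n + 1) y) : L.back n x = L.back n y := by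
  refine back_congr fun i hi => ?_
  have hi' : i ≤ L.back (n + 1) x := hi.trans back_le_back_succ
  have := le_lev_iterate_iff_of_word_eq h (i := L.back (n + 1) x - i)
    ((Nat.sub_le _ _).trans back_lt_ret.le)
  rwa [base_eq_iterate_sub (Nat.sub_le _ _), Nat.sub_sub_self hi', hb,
    base_eq_iterate_sub (Nat.sub_le _ _), Nat.sub_sub_self (hb ▸ hi')] at this

theorem towerWord_eq_of_towerWord_succ_eq (h : L.towerWord (n + 1) x = L.towerWord (n + 1) y)
    (hb : L.back (n + 1) x = L.back (n + 1) y) : L.towerWord n x = L.towerWord n y := by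
  rw [towerWord, towerWord, base_eq_iterate_base_succ (x := x), base_eq_iterate_base_succ (x := y),
    ← hb, ← back_eq_of_towerWord_succ_eq h hb]
  exact word_iterate_eq h ((Nat.sub_le _ _).trans_lt back_lt_ret)

theorem toVert_eq_iff : L.toVert n x = L.toVert n y ↔ L.towerWord n x = L.towerWord n y :=
  Subtype.ext_iff

@[simp]
theorem toVert_base : L.toVert n (L.base n x) = L.toVert n x := toVert_eq_iff.2 towerWord_base

theorem exists_toVert_eq (v : L.Vert n) : ∃ x, n ≤ L.lev x ∧ L.toVert n x = v := by
  obtain ⟨_, x, rfl⟩ := v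
  exact ⟨L.base n x, le_lev_base, toVert_base⟩

theorem toVert_eq_iff_word_eq (hx : n ≤ L.lev x) (hy : n ≤ L.lev y) :
    L.toVert n x = L.toVert n y ↔ L.word n x = L.word n y := by
  rw [toVert_eq_iff, towerWord_of_le hx, towerWord_of_le hy]

variable (L) in
/-- The edge from level `n` to level `n + 1` given by the position of the tower of level `n` through
`x` inside the one of level `n + 1`. -/
def edge (n : ℕ) (x : X) : L.Edge n :=
  ⟨(L.towerWord (n + 1) x, L.back (n + 1) (L.base n x)), L.base n x, le_lev_base,
    Prod.ext towerWord_succ_base rfl⟩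

namespace Edge

/-- The range of an edge. -/
def tgt (e : L.Edge n) : L.Vert (n + 1) :=
  ⟨e.1.1, let ⟨x, _, hx⟩ := e.2; ⟨x, congrArg Prod.fst hx⟩⟩

/-- The height of an edge in the tower that is its range. -/
def pos (e : L.Edge n) : ℕ := e.1.2

/-- The source of an edge. -/
noncomputable def src (e : L.Edge n) : L.Vert n := L.toVert n e.2.choose

theorem ext {e f : L.Edge n} (ht : e.tgt = f.tgt) (hp : e.pos = f.pos) : e = f :=
  Subtype.ext (Prod.ext (congrArg Subtype.val ht) hp)

instance : PartialOrder (L.Edge n) where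
  le e f := e.tgt = f.tgt ∧ e.pos ≤ f.pos
  le_refl _ := ⟨rfl, le_rfl⟩
  le_trans _ _ _ h h' := ⟨h.1.trans h'.1, h.2.trans h'.2⟩
  le_antisymm _ _ h h' := ext h.1 (h.2.antisymm h'.2)

theorem comparable_iff {e f : L.Edge n} : (e ≤ f ∨ f ≤ e) ↔ e.tgt = f.tgt := by
  refine ⟨fun h => h.elim And.left fun h => h.1.symm, fun h => ?_⟩
  exact (le_total e.pos f.pos).imp (fun hp => ⟨h, hp⟩) fun hp => ⟨h.symm, hp⟩

end Edge

@[simp]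
theorem tgt_edge : (L.edge n x).tgt = L.toVert (n + 1) x := rfl

theorem pos_edge : (L.edge n x).pos = L.back (n + 1) (L.base n x) := rfl

theorem pos_edge_of_le (hx : n ≤ L.lev x) : (L.edge n x).pos = L.back (n + 1) x := by
  rw [pos_edge, base_eq_self hx]

@[simp]
theorem src_edge : (L.edge n x).src = L.toVert n x := by
  obtain ⟨-, h⟩ := (L.edge n x).2.choose_spec
  obtain ⟨hword, hback⟩ := Prod.mk.inj h
  rw [Edge.src, ← toVert_base (x := x), toVert_eq_iff]
  exact towerWord_eq_of_towerWord_succ_eq (hword.trans towerWord_succ_base.symm) hback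

theorem exists_edge_eq (e : L.Edge n) : ∃ x, n ≤ L.lev x ∧ L.edge n x = e := by
  obtain ⟨_, x, hx, rfl⟩ := e
  exact ⟨x, hx, Edge.ext rfl (pos_edge_of_le hx)⟩

theorem edge_base : L.edge n (L.base n x) = L.edge n x :=
  Edge.ext (toVert_eq_iff.2 towerWord_succ_base) (pos_edge_of_le le_lev_base)

theorem edge_eq_iff : L.edge n x = L.edge n y ↔ L.towerWord (n + 1) x = L.towerWord (n + 1) y ∧
    L.back (n + 1) (L.base n x) = L.back (n + 1) (L.base n y) :=
  Subtype.ext_iff.trans Prod.mk_inj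

variable (L) in
/-- The heights at which the tower of level `n + 1` over `w` visits `{x | n ≤ lev x}`. -/
def visits (n : ℕ) (w : X) : Finset ℕ :=
  {k ∈ Finset.range (L.ret (n + 1) w) | n ≤ L.lev (T^[k] w)}

theorem mem_visits : k ∈ L.visits n w ↔ k < L.ret (n + 1) w ∧ n ≤ L.lev (T^[k] w) := by
  simp [visits]

theorem visits_eq_of_word_eq (h : L.word (n + 1) x = L.word (n + 1) y) :
    L.visits n x = L.visits n y := by
  ext k
  rw [mem_visits, mem_visits, (word_eq_iff.1 h).1]
  refine and_congr_right fun hk => le_lev_iterate_iff_of_word_eq h ?_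
  rw [(word_eq_iff.1 h).1]
  exact hk.le

theorem back_mem_visits (hx : n ≤ L.lev x) :
    L.back (n + 1) x ∈ L.visits n (L.base (n + 1) x) :=
  mem_visits.2 ⟨back_lt_ret, by rwa [iterate_back_base]⟩

theorem tgt_edge_iterate (hw : n + 1 ≤ L.lev w) (hk : k ∈ L.visits n w) :
    (L.edge n (T^[k] w)).tgt = L.toVert (n + 1) w := by
  rw [tgt_edge, ← toVert_base, base_iterate_of_lt hw (mem_visits.1 hk).1]

theorem pos_edge_iterate (hw : n + 1 ≤ L.lev w) (hk : k ∈ L.visits n w) :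
    (L.edge n (T^[k] w)).pos = k := by
  rw [pos_edge_of_le (mem_visits.1 hk).2, back_iterate_of_lt hw (mem_visits.1 hk).1]

theorem pos_mem_visits (hw : n + 1 ≤ L.lev w) {e : L.Edge n} (he : e.tgt = L.toVert (n + 1) w) :
    e.pos ∈ L.visits n w := by
  obtain ⟨x, hx, rfl⟩ := exists_edge_eq e
  rw [tgt_edge, toVert_eq_iff, towerWord_of_le hw] at he
  rw [pos_edge_of_le hx, ← visits_eq_of_word_eq he]
  exact back_mem_visits hx

theorem edge_iterate_pos (hw : n + 1 ≤ L.lev w) {e : L.Edge n} (he : e.tgt = L.toVert (n + 1) w) :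
    L.edge n (T^[e.pos] w) = e :=
  have hk := pos_mem_visits hw he
  Edge.ext ((tgt_edge_iterate hw hk).trans he.symm) (pos_edge_iterate hw hk)

theorem bijOn_pos (hw : n + 1 ≤ L.lev w) :
    BijOn Edge.pos {e : L.Edge n | e.tgt = L.toVert (n + 1) w} (L.visits n w) :=
  ⟨fun _ he => pos_mem_visits hw he, fun _ he _ hf => Edge.ext (he.trans hf.symm),
    fun k hk => ⟨L.edge n (T^[k] w), tgt_edge_iterate hw hk, pos_edge_iterate hw hk⟩⟩

theorem finite_tgt_eq (v : L.Vert (n + 1)) : {e : L.Edge n | e.tgt = v}.Finite := by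
  obtain ⟨w, hw, rfl⟩ := exists_toVert_eq v
  exact (bijOn_pos hw).finite_iff_finite.2 (L.visits n w).finite_toSet

theorem ncard_tgt_eq (hw : n + 1 ≤ L.lev w) :
    {e : L.Edge n | e.tgt = L.toVert (n + 1) w}.ncard = (L.visits n w).card := by
  rw [(bijOn_pos hw).ncard_eq, ncard_coe_finset]

theorem isMin_edge_iff : IsMin (L.edge n x) ↔ n + 1 ≤ L.lev (L.base n x) := by
  rw [← back_eq_zero_iff, ← pos_edge]
  refine ⟨fun h => ?_, fun h f hf => ⟨hf.1.symm, h ▸ Nat.zero_le _⟩⟩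
  have hb : n + 1 ≤ L.lev (L.base (n + 1) x) := le_lev_base
  have hpos : (L.edge n (L.base (n + 1) x)).pos = 0 := by
    rw [pos_edge_of_le ((Nat.le_succ n).trans hb), back_eq_zero_iff.2 hb]
  have hle : L.edge n (L.base (n + 1) x) ≤ L.edge n x := ⟨toVert_base, by simp [hpos]⟩
  exact Nat.eq_zero_of_le_zero (hpos ▸ (h hle).2)

theorem pos_le_pos_edge {f : L.Edge n} (hf : f.tgt = L.toVert (n + 1) x)
    (hfx : f.pos ≤ L.back (n + 1) x) : f.pos ≤ (L.edge n x).pos :=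
  le_back_succ_base (mem_visits.1 (pos_mem_visits le_lev_base (hf.trans toVert_base.symm))).2 hfx

theorem pos_edge_map (hx : n ≤ L.lev (T x)) (hlt : L.lev (T x) < n + 1) :
    (L.edge n (T x)).pos = L.back (n + 1) x + 1 := by
  rw [pos_edge_of_le hx, back_map hlt]

theorem edge_lt_edge_map (hx : n ≤ L.lev (T x)) (hlt : L.lev (T x) < n + 1) :
    L.edge n x < L.edge n (T x) := by
  have hpos : (L.edge n x).pos < (L.edge n (T x)).pos := by
    rw [pos_edge_map hx hlt, pos_edge, back_succ_base]
    omega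
  have htgt : (L.edge n x).tgt = (L.edge n (T x)).tgt :=
    (toVert_eq_iff.2 (towerWord_map hlt)).symm
  exact lt_of_le_not_ge ⟨htgt, hpos.le⟩ fun h => h.2.not_gt hpos

theorem isMax_edge_iff (hx : n ≤ L.lev (T x)) : IsMax (L.edge n x) ↔ n + 1 ≤ L.lev (T x) := by
  constructor
  · intro h
    by_contra! hlt
    exact h.not_lt (edge_lt_edge_map hx hlt)
  · intro h f hf
    have htgt : f.tgt = L.toVert (n + 1) x := hf.1.symm
    have hlt := (mem_visits.1 (pos_mem_visits le_lev_base (htgt.trans toVert_base.symm))).1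
    have hret : L.ret (n + 1) (L.base (n + 1) x) ≤ L.back (n + 1) x + 1 :=
      ret_le (Nat.succ_pos _) (by rwa [Function.iterate_succ_apply', iterate_back_base])
    exact ⟨htgt, pos_le_pos_edge htgt (by omega)⟩

theorem edge_covBy_edge_map : L.edge (L.lev (T x)) x ⋖ L.edge (L.lev (T x)) (T x) := by
  refine ⟨edge_lt_edge_map le_rfl (Nat.lt_succ_self _), fun f hxf hfT => ?_⟩
  have htgt : f.tgt = L.toVert _ x := hxf.le.1.symm
  have hne : f.pos ≠ (L.edge (L.lev (T x)) (T x)).pos := fun h =>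
    hfT.ne (Edge.ext hfT.le.1 h)
  have hle := hfT.le.2
  rw [pos_edge_map le_rfl (Nat.lt_succ_self _)] at hne hle
  exact hxf.not_ge ⟨htgt, pos_le_pos_edge htgt (by omega)⟩

theorem forall_edge_eq_iff : (∀ i < n, L.edge i x = L.edge i y) ↔
    L.towerWord n x = L.towerWord n y ∧ L.back n x = L.back n y := by
  induction n with
  | zero => simp [towerWord_zero (x := x) (y := y), back_eq_zero_iff.2]
  | succ n ih =>
    have hx : L.back n x ≤ L.back (n + 1) x := back_le_back_succ
    have hy : L.back n y ≤ L.back (n + 1) y := back_le_back_succ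
    rw [Nat.forall_lt_succ_right, ih, edge_eq_iff, back_succ_base, back_succ_base]
    constructor
    · rintro ⟨⟨-, hback⟩, hword, hsub⟩
      exact ⟨hword, by omega⟩
    · rintro ⟨hword, hback⟩
      have hback' := back_eq_of_towerWord_succ_eq hword hback
      exact ⟨⟨towerWord_eq_of_towerWord_succ_eq hword hback, hback'⟩, hword, by omega⟩

theorem code_eq_of_forall_edge_eq (h : ∀ i < n, L.edge i x = L.edge i y) :
    L.code n x = L.code n y :=
  code_eq_of_towerWord_eq (forall_edge_eq_iff.1 h).1 (forall_edge_eq_iff.1 h).2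

variable (L) in
/-- The Borel–Bratteli diagram of a marked level function. -/
noncomputable def diagram [Nonempty X] : BorelBratteli where
  V := L.Vert
  E := L.Edge
  s _ := Edge.src
  r _ := Edge.tgt
  v₀ := L.toVert 0 (Classical.arbitrary X)
  eq_v₀ v := by
    obtain ⟨x, -, rfl⟩ := exists_toVert_eq v
    exact toVert_eq_iff.2 towerWord_zero
  countable_V _ := Subtype.countable
  countable_E _ := Subtype.countable
  source_nonempty n v := by
    obtain ⟨x, -, rfl⟩ := exists_toVert_eq v
    exact ⟨L.edge n x, src_edge⟩
  range_nonempty n v := by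
    obtain ⟨x, -, rfl⟩ := exists_toVert_eq v
    exact ⟨L.edge n x, rfl⟩
  range_finite _ := finite_tgt_eq

variable (L) in
/-- The coding of the points of `X` by the paths of the diagram. -/
def path [Nonempty X] (x : X) : L.diagram.PathSpace :=
  ⟨fun n => L.edge n x, fun _ => src_edge⟩

theorem exists_forall_edge_eq_of_src [Nonempty X] (y : L.diagram.PathSpace) :
    ∀ {n : ℕ} {x : X}, n ≤ L.lev x → L.toVert n x = (y.1 n).src →
      ∃ z, L.base n z = x ∧ ∀ i < n, L.edge i z = y.1 i
  | 0, x, hx, _ => ⟨x, base_eq_self hx, by simp⟩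
  | n + 1, x, hx, hxy => by
    have htgt : (y.1 n).tgt = L.toVert (n + 1) x := (hxy.trans (y.2 n)).symm
    have hk := mem_visits.1 (pos_mem_visits hx htgt)
    have hedge := edge_iterate_pos hx htgt
    obtain ⟨z, hz, hzy⟩ := exists_forall_edge_eq_of_src y hk.2 (by rw [← src_edge, hedge])
    refine ⟨z, ?_, Nat.forall_lt_succ_right.2 ⟨hzy, ?_⟩⟩
    · rw [← base_succ_base, hz, base_iterate_of_lt hx hk.1]
    · rw [← edge_base, hz, hedge]

theorem exists_forall_edge_eq [Nonempty X] (y : L.diagram.PathSpace) (n : ℕ) :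
    ∃ z, ∀ i < n, L.edge i z = y.1 i := by
  obtain ⟨x, hx, hxy⟩ := exists_toVert_eq (y.1 n).src
  obtain ⟨z, -, hz⟩ := exists_forall_edge_eq_of_src y hx hxy
  exact ⟨z, hz⟩

theorem not_isMin_edge (hL : L.IsGradual) (hx : L.lev x < n) : ¬ IsMin (L.edge n x) := by
  rw [isMin_edge_iff, hL.lev_base hx]
  omega

theorem not_isMax_edge (hL : L.IsGradual) (hx : L.lev x < n) : ¬ IsMax (L.edge n x) := by
  set w := L.base n x
  set z := T^[L.ret n w - 1] w
  have hTz : L.lev (T z) = n := by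
    rw [← Function.iterate_succ_apply' T, Nat.succ_eq_add_one, Nat.sub_add_cancel ret_pos]
    exact (hL.lev_iterate_ret_pred (lev_map_base_lt hx)).2
  have hedge : L.edge n z = L.edge n x := by
    rw [← edge_base, base_iterate_of_lt le_lev_base (Nat.sub_lt ret_pos one_pos), edge_base]
  rw [← hedge, isMax_edge_iff hTz.ge, hTz]
  omega

variable (L) in
/-- The ordered Borel–Bratteli diagram of a gradual marked level function for which every path is
the path of a point. -/
noncomputable def orderedDiagram [Nonempty X] (hL : L.IsGradual)
    (hsurj : Function.Surjective L.path) : OrderedBorelBratteli where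
  toBorelBratteli := L.diagram
  order n := inferInstanceAs (PartialOrder (L.Edge n))
  comparable_iff _ _ _ := Edge.comparable_iff
  no_cofinal_max y := by
    obtain ⟨x, rfl⟩ := hsurj y
    rintro ⟨N, hN⟩
    exact not_isMax_edge hL (Nat.lt_succ_of_le (le_max_right N (L.lev x)))
      (hN _ ((le_max_left N _).trans (Nat.le_succ _)))
  no_cofinal_min y := by
    obtain ⟨x, rfl⟩ := hsurj y
    rintro ⟨N, hN⟩
    exact not_isMin_edge hL (Nat.lt_succ_of_le (le_max_right N (L.lev x)))
      (hN _ ((le_max_left N _).trans (Nat.le_succ _)))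

theorem isVershikImage_path [Nonempty X] (hL : L.IsGradual) (hsurj : Function.Surjective L.path)
    (x : X) : (L.orderedDiagram hL hsurj).IsVershikImage (L.path x) (L.path (T x)) := by
  refine ⟨L.lev (T x), fun i hi => (isMax_edge_iff hi.le).2 hi, fun h => ?_, edge_covBy_edge_map,
    fun i hi => edge_eq_iff.2 ⟨?_, ?_⟩, fun i hi => isMin_edge_iff.2 ?_⟩
  · exact ((isMax_edge_iff le_rfl).1 h).not_gt (Nat.lt_succ_self _)
  · exact towerWord_map (hi.trans (Nat.lt_succ_self i))
  · rw [base_map hi]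
  · rwa [base_eq_self hi.le]

theorem path_map [Nonempty X] (hL : L.IsGradual) (hsurj : Function.Surjective L.path) (x : X) :
    L.path (T x) = (L.orderedDiagram hL hsurj).vershik (L.path x) :=
  OrderedBorelBratteli.IsVershikImage.unique _ (isVershikImage_path hL hsurj x)
    (OrderedBorelBratteli.isVershikImage_vershik _ _)

end Diagram

end MarkedLevelFunction

/-! ### Locally constant labels -/

section LocallyConstant

variable {X ι α : Type*} [TopologicalSpace X]

theorem isLocallyConstant_apply_index {f : X → ι} {g : ι → X → α} (hf : IsLocallyConstant f)
    (hg : ∀ i, IsLocallyConstant (g i)) : IsLocallyConstant fun x => g (f x) x := by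
  rw [IsLocallyConstant.iff_eventually_eq]
  intro x
  filter_upwards [hf.eventually_eq x, (hg (f x)).eventually_eq x] with y hfy hgy
  rw [hfy, hgy]

theorem isLocallyConstant_find {p : ℕ → X → Prop} [∀ x, DecidablePred (p · x)]
    (hp : ∀ i, IsLocallyConstant (p i)) (hex : ∀ x, ∃ i, p i x) :
    IsLocallyConstant fun x => Nat.find (hex x) := by
  rw [IsLocallyConstant.iff_eventually_eq]
  intro x
  have hagree : ∀ᶠ y in 𝓝 x, ∀ i ∈ Finset.range (Nat.find (hex x) + 1), p i y = p i x :=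
    (Filter.eventually_all_finset _).2 fun i _ => (hp i).eventually_eq x
  filter_upwards [hagree] with y hy
  exact (Nat.find_congr (Nat.find_spec (hex x)) fun i hi =>
    (hy i (Finset.mem_range_succ_iff.2 hi)).symm.to_iff).symm

theorem isLocallyConstant_list_map (l : List ι) {g : ι → X → α}
    (hg : ∀ i, IsLocallyConstant (g i)) : IsLocallyConstant fun x => l.map (g · x) := by
  rw [IsLocallyConstant.iff_eventually_eq]
  intro x
  classical
  have hagree : ∀ᶠ y in 𝓝 x, ∀ i ∈ l.toFinset, g i y = g i x :=
    (Filter.eventually_all_finset _).2 fun i _ => (hg i).eventually_eq x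
  filter_upwards [hagree] with y hy
  exact List.map_congr_left fun i hi => hy i (List.mem_toFinset.2 hi)

end LocallyConstant

namespace BorelBratteli

theorem isOpen_cylinder (B : BorelBratteli) (y : B.PathSpace) (n : ℕ) :
    IsOpen {z : B.PathSpace | ∀ j < n, z.1 j = y.1 j} := by
  let _ (j : ℕ) : TopologicalSpace (B.E j) := ⊥
  have (j : ℕ) : DiscreteTopology (B.E j) := ⟨rfl⟩
  have hcoord (j : ℕ) : Continuous fun z : B.PathSpace => z.1 j :=
    (continuous_apply j).comp continuous_induced_dom
  simp only [ofPred_forall]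
  exact (Set.finite_Iio n).isOpen_biInter fun j _ =>
    (isOpen_discrete ({y.1 j} : Set (B.E j))).preimage (hcoord j)

theorem continuous_of_isLocallyConstant {X : Type*} [TopologicalSpace X] {B : BorelBratteli}
    {f : X → B.PathSpace} (hf : ∀ n, IsLocallyConstant fun x => (f x).1 n) : Continuous f := by
  let _ (j : ℕ) : TopologicalSpace (B.E j) := ⊥
  exact continuous_induced_rng.2 (continuous_pi fun n => (hf n).continuous)

end BorelBratteli

namespace MarkedLevelFunction

section Topology

open LevelFunction

variable {X : Type*} [TopologicalSpace X] {T : X ≃ₜ X} (L : MarkedLevelFunction T.toEquiv)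

/-- The sets `{x | lev x < n}` form an exhaustion by compact open sets, and the marks are the
indicators of clopen sets separating points from closed sets. -/
structure IsAdapted : Prop where
  isLocallyConstant_lev : IsLocallyConstant L.lev
  isCompact_lev_lt : ∀ n, IsCompact {x | L.lev x < n}
  isLocallyConstant_mark : ∀ i, IsLocallyConstant (L.mark i)
  exists_mark_subset : ∀ x, ∀ O ∈ 𝓝 x, ∃ i, {y | L.mark i y = L.mark i x} ⊆ O

namespace IsAdapted

variable {L} (hL : L.IsAdapted)
include hL

theorem isLocallyConstant_back (n : ℕ) : IsLocallyConstant (L.back n) :=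
  isLocallyConstant_find (fun i => (hL.isLocallyConstant_lev.comp (n ≤ ·)).comp_continuous
    (T.symm.continuous.iterate i)) (L.backward n)

theorem isLocallyConstant_ret (n : ℕ) : IsLocallyConstant (L.ret n) :=
  (isLocallyConstant_find (fun i => (hL.isLocallyConstant_lev.comp (n ≤ ·)).comp_continuous
    ((T.continuous.iterate i).comp T.continuous)) fun x => L.forward n (T x)).comp (· + 1)

theorem isLocallyConstant_code (n : ℕ) : IsLocallyConstant (L.code n) :=
  isLocallyConstant_list_map _ fun i =>
    hL.isLocallyConstant_lev.prodMk (hL.isLocallyConstant_mark i)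

theorem isLocallyConstant_word (n : ℕ) : IsLocallyConstant (L.word n) :=
  isLocallyConstant_apply_index (g := fun r x => (List.range r).map fun i => L.code n (T^[i] x))
    (hL.isLocallyConstant_ret n) fun _ => isLocallyConstant_list_map _ fun i =>
      (hL.isLocallyConstant_code n).comp_continuous (T.continuous.iterate i)

theorem isLocallyConstant_towerWord (n : ℕ) : IsLocallyConstant (L.towerWord n) :=
  isLocallyConstant_apply_index (g := fun b x => L.word n (T.symm^[b] x))
    (hL.isLocallyConstant_back n) fun b =>
      (hL.isLocallyConstant_word n).comp_continuous (T.symm.continuous.iterate b)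

theorem isLocallyConstant_edge (n : ℕ) : IsLocallyConstant (L.edge n) := by
  rw [IsLocallyConstant.iff_eventually_eq]
  intro x
  filter_upwards [(hL.isLocallyConstant_towerWord (n + 1)).eventually_eq x,
    (hL.isLocallyConstant_back (n + 1)).eventually_eq x] with y hword hback
  exact forall_edge_eq_iff.2 ⟨hword, hback⟩ n (Nat.lt_succ_self n)

theorem isCompact_edge_zero_eq (e : L.Edge 0) : IsCompact {x | L.edge 0 x = e} := by
  obtain ⟨p, -, rfl⟩ := exists_edge_eq e
  refine (hL.isCompact_lev_lt (L.lev p + 1)).of_isClosed_subset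
    ((hL.isLocallyConstant_edge 0).isClosed_fiber _) fun x (hx : L.edge 0 x = L.edge 0 p) => ?_
  have hcode : L.code 1 x = L.code 1 p := code_eq_of_forall_edge_eq fun i hi => by
    rwa [Nat.lt_one_iff.1 hi]
  exact Nat.lt_succ_of_le (lev_eq_of_code_eq one_pos hcode).le

theorem exists_cylinder_subset (x : X) {O : Set X} (hO : O ∈ 𝓝 x) :
    ∃ n, {y | ∀ i < n, L.edge i y = L.edge i x} ⊆ O := by
  obtain ⟨i, hi⟩ := hL.exists_mark_subset x O hO
  refine ⟨i + 1, fun y hy => hi ?_⟩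
  exact (code_eq_iff.1 (code_eq_of_forall_edge_eq hy) i (Nat.lt_succ_self i)).2

variable [Nonempty X]

theorem path_surjective : Function.Surjective L.path := by
  intro y
  have hclosed (n : ℕ) : IsClosed {x | ∀ i < n + 1, L.edge i x = y.1 i} := by
    simp only [ofPred_forall]
    exact isClosed_biInter fun i _ => (hL.isLocallyConstant_edge i).isClosed_fiber _
  have hcompact : IsCompact {x | ∀ i < 0 + 1, L.edge i x = y.1 i} := by
    simpa using hL.isCompact_edge_zero_eq (y.1 0)
  obtain ⟨x, hx⟩ := IsCompact.nonempty_iInter_of_sequence_nonempty_isCompact_isClosed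
    (fun n => {x | ∀ i < n + 1, L.edge i x = y.1 i})
    (fun n x hx i hi => hx i (hi.trans (Nat.lt_succ_self _)))
    (fun n => exists_forall_edge_eq y (n + 1)) hcompact hclosed
  exact ⟨x, Subtype.ext (funext fun n => mem_iInter.1 hx n n (Nat.lt_succ_self n))⟩

theorem path_injective [T1Space X] : Function.Injective L.path := by
  intro x y h
  by_contra hne
  obtain ⟨n, hn⟩ := hL.exists_cylinder_subset x (isOpen_compl_singleton.mem_nhds hne)
  exact hn (fun i _ => (congrFun (congrArg Subtype.val h) i).symm) rfl

theorem isInducing_path : IsInducing L.path := by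
  have hcont : Continuous L.path :=
    BorelBratteli.continuous_of_isLocallyConstant hL.isLocallyConstant_edge
  refine isInducing_iff_nhds.2 fun x => le_antisymm (hcont.tendsto x).le_comap fun O hO => ?_
  obtain ⟨n, hn⟩ := hL.exists_cylinder_subset x hO
  exact ⟨_, (L.diagram.isOpen_cylinder (L.path x) n).mem_nhds fun _ _ => rfl, hn⟩

/-- The coding of the points of `X` by paths, as a homeomorphism. -/
noncomputable def pathHomeomorph [T1Space X] : X ≃ₜ L.diagram.PathSpace :=
  (Equiv.ofBijective L.path ⟨hL.path_injective, hL.path_surjective⟩).toHomeomorphOfIsInducing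
    hL.isInducing_path

end IsAdapted

end Topology

end MarkedLevelFunction

/-! ### The special structure -/

namespace MarkedLevelFunction

section Classes

open LevelFunction

variable {X : Type*} {T : X ≃ X} (L : MarkedLevelFunction T)

/-- The towers of level `n` with base in `{x | lev x = j}`: the set `V_{n,j}`. -/
def vertClass (n j : ℕ) : Set (L.Vert n) := L.toVert n '' {x | n ≤ L.lev x ∧ L.lev x = j}

/-- The towers of level `n` of height at least two: the set `V_{n,n}(0)`. -/
def tallClass (n : ℕ) : Set (L.Vert n) := L.toVert n '' L.tallBase n

/-- The towers of level `n` of height one with base in `{x | lev x = n}`: the set `V_{n,n}(1)`. -/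
def flatClass (n : ℕ) : Set (L.Vert n) := L.toVert n '' L.flatBase n

/-- The first mark takes both values on the bases of the towers of each level `n ≥ 1` and height at
least two, so that these towers make up at least two vertices. -/
def SplitsTallBases : Prop :=
  ∀ n, 1 ≤ n → ∃ x ∈ L.tallBase n, ∃ y ∈ L.tallBase n, L.mark 0 x ≠ L.mark 0 y

variable {L} {n j j' : ℕ} {x w : X} {e : L.Edge n}

theorem toVert_mem_vertClass (hn : 1 ≤ n) :
    L.toVert n x ∈ L.vertClass n j ↔ L.lev (L.base n x) = j := by
  rw [← toVert_base]
  refine ⟨?_, fun h => ⟨_, ⟨le_lev_base, h⟩, rfl⟩⟩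
  rintro ⟨y, ⟨hy, rfl⟩, h⟩
  rw [toVert_eq_iff_word_eq hy le_lev_base] at h
  exact (lev_eq_of_code_eq hn ((word_eq_iff.1 h).2 0 ret_pos)).symm

theorem toVert_mem_tallClass : L.toVert n x ∈ L.tallClass n ↔ L.base n x ∈ L.tallBase n := by
  rw [← toVert_base]
  refine ⟨?_, fun h => ⟨_, h, rfl⟩⟩
  rintro ⟨y, ⟨hy, hTy⟩, h⟩
  rw [toVert_eq_iff_word_eq hy le_lev_base] at h
  refine ⟨le_lev_base, ?_⟩
  rwa [← not_le, ← ret_eq_one_iff, ← (word_eq_iff.1 h).1, ret_eq_one_iff, not_le]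

theorem vertClass_self (hL : L.IsGradual) : L.vertClass n n = L.tallClass n ∪ L.flatClass n := by
  rw [vertClass, tallClass, flatClass, ← image_union]
  congr 1
  ext x
  constructor
  · rintro ⟨hx, hxn⟩
    exact (lt_or_ge (L.lev (T x)) n).imp (fun h => ⟨hx, h⟩) fun h => ⟨hxn, h⟩
  · rintro (hx | hx)
    exacts [⟨hx.1, hL.lev_eq hx⟩, ⟨hx.1.ge, hx.1⟩]

theorem disjoint_tallClass_flatClass : Disjoint (L.tallClass n) (L.flatClass n) := by
  rw [Set.disjoint_right]
  rintro _ ⟨x, hx, rfl⟩ h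
  rw [toVert_mem_tallClass, base_eq_self hx.1.ge] at h
  exact h.2.not_ge hx.2

theorem disjoint_vertClass (hn : 1 ≤ n) (h : j ≠ j') :
    Disjoint (L.vertClass n j) (L.vertClass n j') := by
  rw [Set.disjoint_left]
  rintro _ ⟨x, hx, rfl⟩ hj'
  rw [toVert_mem_vertClass hn, base_eq_self hx.1] at hj'
  exact h (hx.2.symm.trans hj')

theorem exists_mem_vertClass (v : L.Vert n) : ∃ j, n ≤ j ∧ v ∈ L.vertClass n j := by
  obtain ⟨x, hx, rfl⟩ := exists_toVert_eq v
  exact ⟨L.lev x, hx, x, ⟨hx, rfl⟩, rfl⟩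

theorem exists_ne_toVert_of_splits (hs : L.SplitsTallBases) (hn : 1 ≤ n) (hj : n ≤ j) :
    ∃ x ∈ L.tallBase j, ∃ y ∈ L.tallBase j, L.toVert n x ≠ L.toVert n y := by
  obtain ⟨x, hx, y, hy, hxy⟩ := hs j (hn.trans hj)
  refine ⟨x, hx, y, hy, fun h => hxy ?_⟩
  rw [toVert_eq_iff_word_eq (hj.trans hx.1) (hj.trans hy.1)] at h
  exact (code_eq_iff.1 ((word_eq_iff.1 h).2 0 ret_pos) 0 hn).2

theorem exists_lev_eq (hL : L.IsGradual) (hs : L.SplitsTallBases) (j : ℕ) : ∃ x, L.lev x = j := by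
  rcases j.eq_zero_or_pos with rfl | hj
  · obtain ⟨x, hx, -⟩ := hs 1 le_rfl
    exact ⟨T x, Nat.lt_one_iff.1 hx.2⟩
  · obtain ⟨x, hx, -⟩ := hs j hj
    exact ⟨x, hL.lev_eq hx⟩

theorem ncard_tgt_eq_one (hw : n + 1 ≤ L.lev w) (hTw : n + 1 ≤ L.lev (T w)) :
    {e : L.Edge n | e.tgt = L.toVert (n + 1) w}.ncard = 1 := by
  have hvisits : L.visits n w = {0} := by
    ext k
    rw [mem_visits, ret_eq_one_iff.2 hTw, Nat.lt_one_iff, Finset.mem_singleton]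
    refine ⟨And.left, fun hk => ⟨hk, ?_⟩⟩
    rw [hk]
    exact (Nat.le_succ n).trans hw
  rw [ncard_tgt_eq hw, hvisits, Finset.card_singleton]

/-- The four edges are the minimal one and those of the last three points of the tower. -/
theorem four_le_ncard_tgt_eq (hL : L.IsGradual) (hw : w ∈ L.tallBase (n + 1)) :
    4 ≤ {e : L.Edge n | e.tgt = L.toVert (n + 1) w}.ncard := by
  have hret : 4 ≤ L.ret (n + 1) w := hL.four_le_ret hw
  set r := L.ret (n + 1) w
  have hlast (i : ℕ) (hi : 1 ≤ i) (hi3 : i ≤ 3) : r - i ∈ L.visits n w :=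
    mem_visits.2 ⟨by omega, Nat.le_of_succ_le_succ
      (hL.lev_iterate_ret_sub hw.2 hi hi3 (by omega)).ge⟩
  have hsub : {0, r - 3, r - 2, r - 1} ⊆ L.visits n w := by
    simp only [Finset.insert_subset_iff, Finset.singleton_subset_iff]
    exact ⟨mem_visits.2 ⟨ret_pos, (Nat.le_succ n).trans hw.1⟩, hlast 3 (by omega) le_rfl,
      hlast 2 (by omega) (by omega), hlast 1 le_rfl (by omega)⟩
  have hcard : ({0, r - 3, r - 2, r - 1} : Finset ℕ).card = 4 := by
    repeat rw [Finset.card_insert_of_notMem (by simp; omega)]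
    rfl
  rw [ncard_tgt_eq hw.1, ← hcard]
  exact Finset.card_le_card hsub

theorem image_src_vertClass (hL : L.IsGradual) (hj : n + 1 < j) :
    Edge.src '' {e : L.Edge n | e.tgt ∈ L.vertClass (n + 1) j} = L.vertClass n j := by
  refine Subset.antisymm ?_ ?_
  · rintro _ ⟨e, he, rfl⟩
    obtain ⟨x, hx, rfl⟩ := exists_edge_eq e
    rw [mem_ofPred_eq, tgt_edge, toVert_mem_vertClass (Nat.succ_pos n)] at he
    rcases lt_or_ge (L.lev x) (n + 1) with hlt | hle
    · exact absurd ((hL.lev_base hlt).symm.trans he) hj.ne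
    · rw [base_eq_self hle] at he
      exact ⟨x, ⟨hx, he⟩, src_edge.symm⟩
  · rintro _ ⟨x, ⟨-, rfl⟩, rfl⟩
    exact ⟨L.edge n x, ⟨x, ⟨hj.le, rfl⟩, rfl⟩, src_edge⟩

theorem src_mem_union_of_tgt_mem (he : e.tgt ∈ L.vertClass (n + 1) (n + 1)) :
    e.src ∈ L.vertClass n n ∪ L.vertClass n (n + 1) := by
  obtain ⟨x, hx, rfl⟩ := exists_edge_eq e
  rw [tgt_edge, toVert_mem_vertClass (Nat.succ_pos n)] at he
  rw [src_edge]
  rcases lt_or_ge (L.lev x) (n + 1) with hlt | hle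
  · exact Or.inl ⟨x, ⟨hx, (Nat.lt_succ_iff.1 hlt).antisymm hx⟩, rfl⟩
  · rw [base_eq_self hle] at he
    exact Or.inr ⟨x, ⟨hx, he⟩, rfl⟩

theorem vertClass_subset_image_src :
    L.vertClass n n ⊆ Edge.src '' {e : L.Edge n | e.tgt ∈ L.tallClass (n + 1)} := by
  rintro _ ⟨x, ⟨-, hx⟩, rfl⟩
  exact ⟨L.edge n x, toVert_mem_tallClass.2 (base_mem_tallBase (Nat.lt_succ_of_le hx.le)), src_edge⟩

theorem image_src_vertClass_self (hL : L.IsGradual) :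
    Edge.src '' {e : L.Edge n | e.tgt ∈ L.vertClass (n + 1) (n + 1)} =
      L.vertClass n n ∪ L.vertClass n (n + 1) := by
  refine Subset.antisymm ?_ (union_subset ?_ ?_)
  · rintro _ ⟨e, he, rfl⟩
    exact src_mem_union_of_tgt_mem he
  · refine vertClass_subset_image_src.trans (image_mono fun e he => ?_)
    rw [mem_ofPred_eq, vertClass_self hL]
    exact Or.inl he
  · rintro _ ⟨x, ⟨-, hxn⟩, rfl⟩
    exact ⟨L.edge n x, ⟨x, ⟨hxn.ge, hxn⟩, rfl⟩, src_edge⟩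

theorem src_mem_of_tgt_mem_flatClass (hL : L.IsGradual) (he : e.tgt ∈ L.flatClass (n + 1)) :
    e.src ∈ L.vertClass n (n + 1) := by
  obtain ⟨x, hx, rfl⟩ := exists_edge_eq e
  have htgt : (L.edge n x).tgt ∈ L.vertClass (n + 1) (n + 1) := by
    rw [vertClass_self hL]
    exact Or.inr he
  have hle : n + 1 ≤ L.lev x := by
    by_contra! hlt
    exact disjoint_tallClass_flatClass.notMem_of_mem_right he
      (toVert_mem_tallClass.2 (base_mem_tallBase hlt))
  rw [tgt_edge, toVert_mem_vertClass (Nat.succ_pos n), base_eq_self hle] at htgt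
  exact ⟨x, ⟨hx, htgt⟩, src_edge.symm⟩

theorem src_mem_of_isMin (hL : L.IsGradual) (he : e.tgt ∈ L.tallClass (n + 1)) (hmin : IsMin e) :
    e.src ∈ L.vertClass n (n + 1) := by
  obtain ⟨x, hx, rfl⟩ := exists_edge_eq e
  rw [isMin_edge_iff, base_eq_self hx] at hmin
  rw [tgt_edge, toVert_mem_tallClass, base_eq_self hmin] at he
  exact ⟨x, ⟨hx, hL.lev_eq he⟩, src_edge.symm⟩

theorem src_mem_of_not_isMin (hmin : ¬ IsMin e) : e.src ∈ L.vertClass n n := by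
  obtain ⟨x, hx, rfl⟩ := exists_edge_eq e
  rw [isMin_edge_iff, base_eq_self hx, not_le, Nat.lt_succ_iff] at hmin
  exact ⟨x, ⟨hx, hmin.antisymm hx⟩, src_edge.symm⟩

theorem src_mem_of_isMax (hL : L.IsGradual) (he : e.tgt ∈ L.tallClass (n + 1)) (hmax : IsMax e) :
    e.src ∈ L.flatClass n := by
  obtain ⟨w, hw, htgt⟩ := he
  obtain ⟨hpred, hret⟩ := hL.lev_iterate_ret_pred hw.2
  have hlt : L.ret (n + 1) w - 1 < L.ret (n + 1) w := Nat.sub_lt ret_pos one_pos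
  set z := T^[L.ret (n + 1) w - 1] w with hz
  have hTz : L.lev (T z) = n + 1 := by
    rwa [hz, ← Function.iterate_succ_apply' T, Nat.succ_eq_add_one, Nat.sub_add_cancel ret_pos]
  have hzn : n ≤ L.lev (T z) := hTz ▸ Nat.le_succ n
  have hzmax : IsMax (L.edge n z) := (isMax_edge_iff hzn).2 hTz.ge
  have hztgt : (L.edge n z).tgt = e.tgt := by
    rw [← htgt, tgt_edge, ← toVert_base, base_iterate_of_lt hw.1 hlt]
  have hez : e = L.edge n z := by
    rcases Edge.comparable_iff.2 hztgt with h | h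
    exacts [(hzmax.eq_of_le h).symm, hmax.eq_of_le h]
  rw [hez, src_edge]
  exact ⟨z, ⟨by omega, hzn⟩, rfl⟩

end Classes

section SpecialModel

open LevelFunction

variable {X : Type*} [TopologicalSpace X] {T : X ≃ₜ X} {L : MarkedLevelFunction T.toEquiv} {n j : ℕ}

theorem finite_vertClass (hL : L.IsAdapted) : (L.vertClass n j).Finite := by
  let _ : TopologicalSpace (List (List (ℕ × Bool))) := ⊥
  have : DiscreteTopology (List (List (ℕ × Bool))) := ⟨rfl⟩
  have hcompact : IsCompact {x | L.lev x = j} :=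
    (hL.isCompact_lev_lt (j + 1)).of_isClosed_subset (hL.isLocallyConstant_lev.isClosed_fiber j)
      fun x (hx : L.lev x = j) => Nat.lt_succ_of_le hx.le
  have hfin : (L.towerWord n '' {x | L.lev x = j}).Finite :=
    (hcompact.image (hL.isLocallyConstant_towerWord n).continuous).finite_of_discrete
  refine Set.Finite.of_finite_image (f := Subtype.val) (hfin.subset ?_)
    Subtype.val_injective.injOn
  rintro _ ⟨_, ⟨x, ⟨-, hx⟩, rfl⟩, rfl⟩
  exact ⟨x, hx, rfl⟩

theorem two_le_ncard_vertClass (hL : L.IsAdapted) (hg : L.IsGradual) (hs : L.SplitsTallBases)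
    (hn : 1 ≤ n) (hj : n ≤ j) : 2 ≤ (L.vertClass n j).ncard := by
  obtain ⟨x, hx, y, hy, hxy⟩ := exists_ne_toVert_of_splits hs hn hj
  exact (Set.one_lt_ncard (finite_vertClass hL)).2 ⟨_, ⟨x, ⟨hj.trans hx.1, hg.lev_eq hx⟩, rfl⟩,
    _, ⟨y, ⟨hj.trans hy.1, hg.lev_eq hy⟩, rfl⟩, hxy⟩

theorem two_le_ncard_tallClass (hL : L.IsAdapted) (hg : L.IsGradual) (hs : L.SplitsTallBases)
    (hn : 1 ≤ n) : 2 ≤ (L.tallClass n).ncard := by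
  obtain ⟨x, hx, y, hy, hxy⟩ := exists_ne_toVert_of_splits hs hn le_rfl
  have hsub : L.tallClass n ⊆ L.vertClass n n := vertClass_self hg ▸ subset_union_left
  exact (Set.one_lt_ncard ((finite_vertClass hL).subset hsub)).2
    ⟨_, ⟨x, hx, rfl⟩, _, ⟨y, hy, rfl⟩, hxy⟩

variable [Nonempty X]

theorem isSpecial_orderedDiagram (hL : L.IsAdapted) (hg : L.IsGradual) (hs : L.SplitsTallBases) :
    (L.orderedDiagram hg hL.path_surjective).IsSpecial := by
  have hself (n : ℕ) : L.vertClass n n = L.tallClass n ∪ L.flatClass n := vertClass_self hg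
  refine ⟨{
    VC := L.vertClass
    VC0 := L.tallClass
    VC1 := L.flatClass
    EC := fun n j => {e : L.Edge n | e.tgt ∈ L.vertClass (n + 1) j}
    EC0 := fun n => {e : L.Edge n | e.tgt ∈ L.tallClass (n + 1)}
    EC1 := fun n => {e : L.Edge n | e.tgt ∈ L.flatClass (n + 1)}
    VC_zero := fun j => ?_
    VC_cover := fun _ _ v => exists_mem_vertClass v
    VC_disjoint := fun _ hn _ _ _ _ h => disjoint_vertClass hn h
    VC_finite := fun _ _ _ _ => finite_vertClass hL
    VC_two_le := fun _ hn _ hj => two_le_ncard_vertClass hL hg hs hn hj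
    VC_diag := fun n _ => hself n
    VC_diag_disjoint := fun _ _ => disjoint_tallClass_flatClass
    VC0_two_le := fun _ hn => two_le_ncard_tallClass hL hg hs hn
    EC_cover := fun _ e => exists_mem_vertClass (Edge.tgt e)
    EC_disjoint := fun n _ _ _ _ h => (disjoint_vertClass (Nat.succ_pos n) h).preimage Edge.tgt
    EC_finite := fun _ _ _ => (finite_vertClass hL).preimage' fun v _ => finite_tgt_eq v
    EC_source := fun _ _ hj => image_src_vertClass hg hj
    EC_range := fun _ _ _ _ he => he
    EC_diag := fun n => congrArg (Edge.tgt ⁻¹' ·) (hself (n + 1))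
    EC_diag_disjoint := fun _ => disjoint_tallClass_flatClass.preimage Edge.tgt
    EC_diag_source := fun _ => image_src_vertClass_self hg
    EC0_source := fun n _ he => src_mem_union_of_tgt_mem (hself (n + 1) ▸ Or.inl he)
    subset_EC0_source := fun _ => vertClass_subset_image_src
    EC0_range := fun _ _ he => he
    EC1_source := fun _ _ he => src_mem_of_tgt_mem_flatClass hg he
    EC1_range := fun _ _ he => he
    card_range := fun n j hj v hv => ?_
    card_range_one := fun n v hv => ?_
    card_range_zero := fun n v hv => ?_
    source_min := fun _ _ he hmin => src_mem_of_isMin hg he hmin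
    source_mid := fun _ _ _ hmin _ => src_mem_of_not_isMin hmin
    source_max := fun _ _ he hmax => Or.inl (src_mem_of_isMax hg he hmax) }⟩
  · obtain ⟨x, hx⟩ := exists_lev_eq hg hs j
    refine Subset.antisymm (fun v _ => L.diagram.eq_v₀ v) ?_
    rintro _ rfl
    exact ⟨x, ⟨Nat.zero_le _, hx⟩, L.diagram.eq_v₀ _⟩
  · obtain ⟨w, ⟨hw, rfl⟩, rfl⟩ := hv
    exact ncard_tgt_eq_one hw (Nat.lt_succ_iff.1 (hj.trans_le (hg.lev_le w)))
  · obtain ⟨w, hw, rfl⟩ := hv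
    exact ncard_tgt_eq_one hw.1.ge hw.2
  · obtain ⟨w, hw, rfl⟩ := hv
    exact four_le_ncard_tgt_eq hg hw

theorem exists_isSpecial_conj_vershik [T1Space X] (hL : L.IsAdapted) (hg : L.IsGradual)
    (hs : L.SplitsTallBases) :
    ∃ B : OrderedBorelBratteli, B.IsSpecial ∧
      ∃ F : X ≃ₜ B.PathSpace, ∀ x, F (T x) = B.vershik (F x) :=
  ⟨L.orderedDiagram hg hL.path_surjective, isSpecial_orderedDiagram hL hg hs, hL.pathHomeomorph,
    path_map hg hL.path_surjective⟩

end SpecialModel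

end MarkedLevelFunction

/-! ### Existence of gradual level functions -/

/-- The sequence of sets obtained by closing up, at each step, under `T⁻¹` and the first three
iterates of `T`, and by adding `W n`. -/
def exhaustion {X : Type*} (T : X → X) (W : ℕ → Set X) : ℕ → Set X
  | 0 => ∅
  | n + 1 => ⋃ i ∈ Finset.range 4, T^[i] '' (exhaustion T W n ∪ T ⁻¹' exhaustion T W n ∪ W n)

section Exhaustion

variable {X : Type*} {W : ℕ → Set X} {n i : ℕ} {x : X}

theorem mem_exhaustion_succ {T : X → X} : x ∈ exhaustion T W (n + 1) ↔
    ∃ i < 4, ∃ y ∈ exhaustion T W n ∪ T ⁻¹' exhaustion T W n ∪ W n, T^[i] y = x := by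
  simp only [exhaustion, mem_iUnion, Finset.mem_range, exists_prop, mem_image]

theorem subset_exhaustion_succ {T : X → X} :
    exhaustion T W n ∪ T ⁻¹' exhaustion T W n ∪ W n ⊆ exhaustion T W (n + 1) :=
  fun x hx => mem_exhaustion_succ.2 ⟨0, four_pos, x, hx, rfl⟩

theorem monotone_exhaustion {T : X → X} : Monotone (exhaustion T W) :=
  monotone_nat_of_le_succ fun _ =>
    (subset_union_left.trans subset_union_left).trans subset_exhaustion_succ

theorem iterate_mem_exhaustion_succ {T : X → X} (hi : i < 4) (hx : x ∈ exhaustion T W n) :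
    T^[i] x ∈ exhaustion T W (n + 1) :=
  mem_exhaustion_succ.2 ⟨i, hi, x, Or.inl (Or.inl hx), rfl⟩

theorem symm_iterate_mem_exhaustion_sdiff {T : X ≃ X} (hx : x ∈ exhaustion T W (n + 1))
    (hTx : T x ∉ exhaustion T W (n + 1)) (hi : i < 3) :
    T.symm^[i] x ∈ exhaustion T W (n + 1) \ exhaustion T W n := by
  obtain ⟨j, hj, y, hy, rfl⟩ := mem_exhaustion_succ.1 hx
  obtain rfl : j = 3 := by
    by_contra hne
    exact hTx (mem_exhaustion_succ.2 ⟨j + 1, by omega, y, hy, Function.iterate_succ_apply' T j y⟩)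
  refine ⟨?_, fun h => hTx ?_⟩
  · rw [iterate_iterate_of_leftInverse T.leftInverse_symm hi.le]
    exact mem_exhaustion_succ.2 ⟨3 - i, by omega, y, hy, rfl⟩
  · have := iterate_mem_exhaustion_succ (i := i + 1) (by omega) h
    rwa [Function.iterate_succ_apply',
      iterate_iterate_of_leftInverse T.rightInverse_symm le_rfl, Nat.sub_self] at this

theorem isCompact_exhaustion [TopologicalSpace X] {T : X ≃ₜ X} (hW : ∀ n, IsCompact (W n)) (n : ℕ) :
    IsCompact (exhaustion T W n) := by
  induction n with
  | zero => exact isCompact_empty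
  | succ n ih =>
    exact (Finset.range 4).isCompact_biUnion fun i _ =>
      ((ih.union (T.isCompact_preimage.2 ih)).union (hW n)).image (T.continuous.iterate i)

theorem isOpen_exhaustion [TopologicalSpace X] {T : X ≃ₜ X} (hW : ∀ n, IsOpen (W n)) (n : ℕ) :
    IsOpen (exhaustion T W n) := by
  induction n with
  | zero => exact isOpen_empty
  | succ n ih =>
    refine isOpen_biUnion fun i _ => ?_
    rw [image_eq_preimage_of_inverse (Function.LeftInverse.iterate T.symm_apply_apply i)
      (Function.RightInverse.iterate T.apply_symm_apply i)]
    exact ((ih.union (ih.preimage T.continuous)).union (hW n)).preimage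
      (T.symm.continuous.iterate i)

end Exhaustion

theorem exists_forall_lt_iff_mem {X : Type*} {C : ℕ → Set X} (hC : Monotone C) (h0 : C 0 = ∅)
    (hcover : ∀ x, ∃ n, x ∈ C n) : ∃ lev : X → ℕ, ∀ n x, lev x < n ↔ x ∈ C n := by
  classical
  refine ⟨fun x => Nat.find (hcover x) - 1, fun n x => ?_⟩
  have hpos : 0 < Nat.find (hcover x) := (Nat.find_pos _).2 (by simp [h0])
  have hfind : Nat.find (hcover x) ≤ n ↔ x ∈ C n :=
    ⟨fun h => hC h (Nat.find_spec (hcover x)), Nat.find_min' (hcover x)⟩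
  rw [← hfind]
  change Nat.find (hcover x) - 1 < n ↔ _
  omega

theorem isLocallyConstant_of_forall_lt_iff_mem {X : Type*} [TopologicalSpace X] {lev : X → ℕ}
    {C : ℕ → Set X} (hlev : ∀ n x, lev x < n ↔ x ∈ C n) (hC : ∀ n, IsClopen (C n)) :
    IsLocallyConstant lev := by
  refine IsLocallyConstant.iff_isOpen_fiber.2 fun n => ?_
  convert! (hC (n + 1)).isOpen.sdiff (hC n).isClosed using 1
  ext x
  rw [mem_sdiff, ← hlev, ← hlev, mem_preimage, mem_singleton_iff]
  omega

theorem LevelFunction.isGradual_of_forall_lt_iff {X : Type*} {T : X ≃ X} {L : LevelFunction T}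
    {W : ℕ → Set X} (hL : ∀ n x, L.lev x < n ↔ x ∈ exhaustion T W n) : L.IsGradual := by
  have hmem (x : X) : x ∈ exhaustion T W (L.lev x + 1) := (hL _ x).1 (Nat.lt_succ_self _)
  refine ⟨fun x => ?_, fun x hx => ?_, fun x hx i hi => ?_⟩
  · exact Nat.le_of_lt_succ <| (hL _ x).2 <| subset_exhaustion_succ <| Or.inl <| Or.inr <|
      hmem (T x)
  · have := (hL _ (T x)).2 (iterate_mem_exhaustion_succ (i := 1) (by omega) (hmem x))
    omega
  · have hexit : T x ∉ exhaustion T W (L.lev x + 1) := by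
      rw [← hL]
      omega
    obtain ⟨hle, hge⟩ := symm_iterate_mem_exhaustion_sdiff (hmem x) hexit hi
    rw [← hL] at hle hge
    omega

/-- Every orbit of `f` leaves every compact set. -/
def EscapesCompacts {X : Type*} [TopologicalSpace X] (f : X → X) : Prop :=
  ∀ K, IsCompact K → ∀ x, ∃ i, f^[i] x ∉ K

theorem exists_levelFunction {X : Type*} [TopologicalSpace X] {T : X ≃ₜ X}
    (hf : EscapesCompacts T) (hb : EscapesCompacts T.symm) {W : ℕ → Set X}
    (hWc : ∀ n, IsCompact (W n)) (hcover : ∀ x, ∃ n, x ∈ W n) :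
    ∃ L : LevelFunction T.toEquiv, ∀ n x, L.lev x < n ↔ x ∈ exhaustion T W n := by
  obtain ⟨lev, hlev⟩ := exists_forall_lt_iff_mem (monotone_exhaustion (T := T) (W := W)) rfl
    fun x => (hcover x).imp' (· + 1) fun n hn => subset_exhaustion_succ (Or.inr hn)
  have hout {n x} (hx : x ∉ exhaustion T W n) : n ≤ lev x := not_lt.1 (mt (hlev n x).1 hx)
  exact ⟨⟨lev, fun n x => (hf _ (isCompact_exhaustion hWc n) x).imp fun _ => hout,
    fun n x => (hb _ (isCompact_exhaustion hWc n) x).imp fun _ => hout⟩, hlev⟩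

/-! ### The general theorem -/

section Marks

variable {X : Type*} [TopologicalSpace X]

theorem isLocallyConstant_boolIndicator {s : Set X} (hs : IsClopen s) :
    IsLocallyConstant s.boolIndicator :=
  (IsLocallyConstant.iff_continuous _).2 ((continuous_boolIndicator_iff_isClopen s).2 hs)

theorem exists_splitting_mark [TotallySeparatedSpace X] {T : X ≃ X} {L : LevelFunction T}
    (hg : L.IsGradual) (hL : IsLocallyConstant L.lev)
    (hinf : ∀ n, 1 ≤ n → (L.tallBase n).Infinite) :
    ∃ m : X → Bool, IsLocallyConstant m ∧
      ∀ n, 1 ≤ n → ∃ x ∈ L.tallBase n, ∃ y ∈ L.tallBase n, m x ≠ m y := by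
  have hsep (n : ℕ) : ∃ O : Set X, IsClopen O ∧
      (1 ≤ n → ∃ x ∈ L.tallBase n, ∃ y ∈ L.tallBase n, x ∈ O ∧ y ∉ O) := by
    obtain rfl | hn := n.eq_zero_or_pos
    · exact ⟨∅, isClopen_empty, by omega⟩
    · obtain ⟨x, hx, y, hy, hxy⟩ := (hinf n hn).nontrivial
      obtain ⟨O, hO, hxO, hyO⟩ := exists_isClopen_of_totally_separated hxy
      exact ⟨O, hO, fun _ => ⟨x, hx, y, hy, hxO, hyO⟩⟩
  choose O hO hsplit using hsep
  refine ⟨fun x => (O (L.lev x)).boolIndicator x, isLocallyConstant_apply_index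
    (g := fun n => (O n).boolIndicator) hL fun n => isLocallyConstant_boolIndicator (hO n),
    fun n hn => ?_⟩
  obtain ⟨x, hx, y, hy, hxO, hyO⟩ := hsplit n hn
  refine ⟨x, hx, y, hy, ?_⟩
  simp only [hg.lev_eq hx, hg.lev_eq hy]
  rw [(mem_iff_boolIndicator _ _).1 hxO, (notMem_iff_boolIndicator _ _).1 hyO]
  exact Bool.noConfusion

theorem MarkedLevelFunction.isAdapted_of_isTopologicalBasis {T : X ≃ₜ X}
    {L : MarkedLevelFunction T.toEquiv} {C U : ℕ → Set X}
    (hC : ∀ n, IsClopen (C n) ∧ IsCompact (C n)) (hlev : ∀ n x, L.lev x < n ↔ x ∈ C n)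
    (hmark : ∀ i, IsLocallyConstant (L.mark i))
    (hU : TopologicalSpace.IsTopologicalBasis (range U))
    (hmarkU : ∀ i, L.mark (i + 1) = (U i).boolIndicator) : L.IsAdapted where
  isLocallyConstant_lev := isLocallyConstant_of_forall_lt_iff_mem hlev fun n => (hC n).1
  isCompact_lev_lt n := by
    convert! (hC n).2 using 1
    exact Set.ext (hlev n)
  isLocallyConstant_mark := hmark
  exists_mark_subset x O hO := by
    obtain ⟨_, ⟨i, rfl⟩, hx, hi⟩ := hU.mem_nhds_iff.1 hO
    refine ⟨i + 1, fun y hy => hi ((mem_iff_boolIndicator _ _).2 ?_)⟩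
    rw [← (mem_iff_boolIndicator _ _).1 hx, ← hmarkU]
    exact hy

theorem prespectralSpace_of_isTopologicalBasis_isClopen [LocallyCompactSpace X]
    (hX : TopologicalSpace.IsTopologicalBasis {U : Set X | IsClopen U}) : PrespectralSpace X := by
  refine ⟨TopologicalSpace.isTopologicalBasis_of_isOpen_of_nhds (fun U hU => hU.1) ?_⟩
  intro x O hx hO
  obtain ⟨K, hK, hKO, hKc⟩ := local_compact_nhds (hO.mem_nhds hx)
  obtain ⟨V, hV, hxV, hVK⟩ := hX.mem_nhds_iff.1 hK
  exact ⟨V, ⟨hV.isOpen, hKc.of_isClosed_subset hV.isClosed hVK⟩, hxV, hVK.trans hKO⟩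

theorem exists_isTopologicalBasis_range [PrespectralSpace X] [SecondCountableTopology X] :
    ∃ U : ℕ → Set X, (∀ n, IsOpen (U n) ∧ IsCompact (U n)) ∧
      TopologicalSpace.IsTopologicalBasis (range U) := by
  obtain ⟨s, hs, hcount, hbasis⟩ := (PrespectralSpace.isTopologicalBasis (X := X)).exists_countable
  obtain ⟨U, hU⟩ := (hcount.insert ∅).exists_eq_range (insert_nonempty _ _)
  have hsub : insert ∅ s ⊆ {U : Set X | IsOpen U ∧ IsCompact U} :=
    insert_subset ⟨isOpen_empty, isCompact_empty⟩ hs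
  exact ⟨U, fun n => hsub (hU ▸ mem_range_self n), hU ▸ hbasis.insert_empty⟩

theorem exists_infinite_of_not_discreteTopology [T1Space X] (hX : ¬ DiscreteTopology X)
    {ι : Type*} {U : ι → Set X} (hU : ∀ i, IsOpen (U i)) (hcover : ∀ x, ∃ i, x ∈ U i) :
    ∃ i, (U i).Infinite := by
  by_contra! hfin
  refine hX (discreteTopology_iff_isOpen_singleton.2 fun x => ?_)
  obtain ⟨i, hi⟩ := hcover x
  exact isOpen_singleton_of_finite_mem_nhds x ((hU i).mem_nhds hi) (hfin i)

theorem exists_markedLevelFunction [T2Space X] [SecondCountableTopology X] [PrespectralSpace X]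
    (hdisc : ¬ DiscreteTopology X) {T : X ≃ₜ X} (hf : EscapesCompacts T)
    (hb : EscapesCompacts T.symm) :
    ∃ L : MarkedLevelFunction T.toEquiv, L.IsAdapted ∧ L.IsGradual ∧ L.SplitsTallBases := by
  obtain ⟨U, hU, hbasis⟩ := exists_isTopologicalBasis_range (X := X)
  have hcover (x : X) : ∃ i, x ∈ U i := by
    simpa using hbasis.exists_subset_of_mem_open (mem_univ x) isOpen_univ
  obtain ⟨m, hm⟩ := exists_infinite_of_not_discreteTopology hdisc (fun i => (hU i).1) hcover
  let W (n : ℕ) : Set X := U m ∪ U n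
  obtain ⟨L, hL⟩ := exists_levelFunction hf hb (W := W) (fun n => (hU m).2.union (hU n).2)
    fun x => (hcover x).imp fun _ => Or.inr
  have hcompact : ∀ n, IsCompact (exhaustion T W n) :=
    isCompact_exhaustion fun n => (hU m).2.union (hU n).2
  have hclopen (n : ℕ) : IsClopen (exhaustion T W n) :=
    ⟨(hcompact n).isClosed, isOpen_exhaustion (fun n => (hU m).1.union (hU n).1) n⟩
  have hg : L.IsGradual := LevelFunction.isGradual_of_forall_lt_iff hL
  have hinf : ∀ n, 1 ≤ n → (L.tallBase n).Infinite := fun n hn => by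
    obtain ⟨n, rfl⟩ := Nat.exists_eq_add_one.2 hn
    exact LevelFunction.infinite_tallBase <| hm.mono fun x hx =>
      (hL _ x).2 (subset_exhaustion_succ (Or.inr (Or.inl hx)))
  obtain ⟨c, hc, hsplit⟩ := exists_splitting_mark hg
    (isLocallyConstant_of_forall_lt_iff_mem hL hclopen) hinf
  let mark (i : ℕ) : X → Bool := Nat.casesOn i c fun i => (U i).boolIndicator
  have hmark : ∀ i, IsLocallyConstant (mark i)
    | 0 => hc
    | i + 1 => isLocallyConstant_boolIndicator ⟨(hU i).2.isClosed, (hU i).1⟩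
  exact ⟨⟨L, mark⟩, MarkedLevelFunction.isAdapted_of_isTopologicalBasis
    (fun n => ⟨hclopen n, hcompact n⟩) hL hmark hbasis fun _ => rfl, hg, hsplit⟩

end Marks

theorem theorem4p4_general {X : Type*} [TopologicalSpace X] [T2Space X]
    [SecondCountableTopology X] [LocallyCompactSpace X]
    (hX : TopologicalSpace.IsTopologicalBasis {U : Set X | IsClopen U})
    (hdisc : ¬ DiscreteTopology X) (T : X ≃ₜ X) (hf : EscapesCompacts T)
    (hb : EscapesCompacts T.symm) :
    ∃ B : OrderedBorelBratteli, B.IsSpecial ∧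
      ∃ F : X ≃ₜ B.PathSpace, ∀ x, F (T x) = B.vershik (F x) := by
  have : PrespectralSpace X := prespectralSpace_of_isTopologicalBasis_isClopen hX
  have : Nonempty X := not_isEmpty_iff.1 fun _ => hdisc inferInstance
  obtain ⟨L, hL, hg, hs⟩ := exists_markedLevelFunction hdisc hf hb
  exact L.exists_isSpecial_conj_vershik hL hg hs

/-! ### Markers -/

section VanishingMarkers

variable {X : Type*} [TopologicalSpace X] {T : X ≃ₜ X}

theorem homeomorph_pow_apply (T : X ≃ₜ X) (i : ℕ) (x : X) : (T ^ i) x = T^[i] x :=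
  congrFun (hom_coe_pow (fun T : X ≃ₜ X => (T : X → X)) rfl (fun _ _ => rfl) T i) x

theorem IsCompleteSection.inv {S : Set X} (hS : IsCompleteSection T S) :
    IsCompleteSection T⁻¹ S := fun x => by
  obtain ⟨k, hk⟩ := hS x
  exact ⟨-k, by rwa [inv_zpow', neg_neg]⟩

theorem IsCompleteSection.exists_iterate_mem {S : Set X} (hS : IsCompleteSection T S)
    (hrec : ∀ x ∈ S, {m : ℕ | (T ^ m) x ∈ S}.Infinite) (x : X) : ∃ i, T^[i] x ∈ S := by
  obtain ⟨k, hk⟩ := hS x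
  obtain ⟨m, hm, hlt⟩ := (hrec _ hk).exists_gt k.natAbs
  have hcast : ((m + k).toNat : ℤ) = m + k := Int.toNat_of_nonneg (by omega)
  refine ⟨(m + k).toNat, ?_⟩
  rw [← homeomorph_pow_apply, ← zpow_natCast, hcast, zpow_add, zpow_natCast]
  exact hm

theorem LevelFunction.mem_towerBase_ret {L : LevelFunction T.toEquiv} {S : Set X} {n : ℕ}
    (hL : ∀ x, n ≤ L.lev x ↔ x ∈ S) {x : X} (hx : x ∈ S) : x ∈ towerBase T S (L.ret n x) := by
  refine ⟨hx, ?_, fun i hi hir => ?_⟩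
  · rw [homeomorph_pow_apply, ← hL]
    exact le_lev_iterate_ret
  · rw [homeomorph_pow_apply, ← hL, not_le]
    exact lev_iterate_lt_of_lt_ret hi hir

namespace IsVanishingMarkers

variable [MeasurableSpace X] {A : ℕ → Set X}

theorem exists_levelFunction (hA : IsVanishingMarkers T A) :
    ∃ L : LevelFunction T.toEquiv, ∀ n x, n ≤ L.lev x ↔ x ∈ A n := by
  obtain ⟨lev, hlev⟩ := exists_forall_lt_iff_mem (C := fun n => (A n)ᶜ)
    (monotone_nat_of_le_succ fun n => compl_subset_compl.2 (hA.antitone n))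
    (by rw [hA.zero, compl_univ])
    (fun x => by simpa using (hA.inter ▸ notMem_empty x : x ∉ ⋂ n, A n))
  have hmem (n : ℕ) (x : X) : n ≤ lev x ↔ x ∈ A n := by
    rw [← not_lt, hlev, notMem_compl_iff]
  refine ⟨⟨lev, fun n x => ?_, fun n x => ?_⟩, hmem⟩ <;> simp only [hmem] <;>
    obtain rfl | hn := n.eq_zero_or_pos
  · exact ⟨0, hA.zero ▸ mem_univ _⟩
  · exact (hA.section_self n hn).exists_iterate_mem (hA.recurrent_pos n hn) x
  · exact ⟨0, hA.zero ▸ mem_univ _⟩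
  · exact (hA.section_self n hn).inv.exists_iterate_mem (hA.recurrent_neg n hn) x

theorem isClosed (hA : IsVanishingMarkers T A) (hclopen : HasClopenTowers T A) {n : ℕ}
    (hn : 1 ≤ n) : IsClosed (A n) := by
  obtain ⟨L, hL⟩ := hA.exists_levelFunction
  rw [← isOpen_compl_iff, isOpen_iff_mem_nhds]
  intro x hx
  have hpos : 0 < L.back n x := LevelFunction.back_pos_iff.2 (not_le.1 (mt (hL n x).1 hx))
  have hlt : L.back n x < L.ret n (L.base n x) := LevelFunction.back_lt_ret
  have hx' : x ∈ (T ^ L.back n x) '' towerBase T (A n) (L.ret n (L.base n x)) := by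
    refine ⟨L.base n x, LevelFunction.mem_towerBase_ret (hL n)
      ((hL n _).1 LevelFunction.le_lev_base), ?_⟩
    rw [homeomorph_pow_apply]
    exact LevelFunction.iterate_back_base
  refine Filter.mem_of_superset ((hclopen n hn _ _ hlt).isOpen.mem_nhds hx') ?_
  rintro _ ⟨w, hw, rfl⟩
  exact hw.2.2 _ hpos hlt

theorem exists_disjoint (hA : IsVanishingMarkers T A) (hclopen : HasClopenTowers T A)
    {K : Set X} (hK : IsCompact K) : ∃ n, Disjoint K (A n) := by
  have hempty : K ∩ ⋂ n, A (n + 1) = ∅ := by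
    rw [(antitone_nat_of_succ_le hA.antitone).iInter_nat_add, hA.inter, inter_empty]
  obtain ⟨n, hn⟩ := hK.elim_directed_family_closed (fun n => A (n + 1))
    (fun n => hA.isClosed hclopen (Nat.succ_pos n)) hempty
    (antitone_nat_of_succ_le fun n => hA.antitone (n + 1)).directed_ge
  exact ⟨n + 1, disjoint_iff_inter_eq_empty.2 hn⟩

theorem escapesCompacts (hA : IsVanishingMarkers T A) (hclopen : HasClopenTowers T A) :
    EscapesCompacts T ∧ EscapesCompacts T.symm := by
  obtain ⟨L, hL⟩ := hA.exists_levelFunction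
  refine ⟨fun K hK x => ?_, fun K hK x => ?_⟩ <;>
    obtain ⟨n, hn⟩ := hA.exists_disjoint hclopen hK
  · exact (L.forward n x).imp fun _ hi => disjoint_right.1 hn ((hL n _).1 hi)
  · exact (L.backward n x).imp fun _ hi => disjoint_right.1 hn ((hL n _).1 hi)

theorem uncountable_space [Nonempty X] (hA : IsVanishingMarkers T A) : Uncountable X := by
  obtain ⟨L, hL⟩ := hA.exists_levelFunction
  obtain ⟨x⟩ := ‹Nonempty X›
  have hx : L.base 1 x ∈ towerBase T (A 1) (L.ret 1 (L.base 1 x)) :=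
    LevelFunction.mem_towerBase_ret (hL 1) ((hL 1 _).1 LevelFunction.le_lev_base)
  exact ⟨fun _ => hA.uncountable 1 le_rfl _ LevelFunction.ret_pos ⟨_, hx⟩ (to_countable _)⟩

theorem not_discreteTopology [SecondCountableTopology X] [Nonempty X]
    (hA : IsVanishingMarkers T A) : ¬ DiscreteTopology X := fun _ =>
  hA.uncountable_space.not_countable (TopologicalSpace.separableSpace_iff_countable.1 inferInstance)

end IsVanishingMarkers

end VanishingMarkers

theorem theorem4p4 {X : Type*} [TopologicalSpace X] [PolishSpace X] [LocallyCompactSpace X]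
    [MeasurableSpace X] [BorelSpace X] [Nonempty X]
    (hX : TopologicalSpace.IsTopologicalBasis {U : Set X | IsClopen U})
    (T : X ≃ₜ X) (hT : IsAperiodic T)
    (A : ℕ → Set X) (hA : IsVanishingMarkers T A) (hclopen : HasClopenTowers T A) :
    ∃ B : OrderedBorelBratteli, B.IsSpecial ∧
      ∃ F : X ≃ₜ B.PathSpace, ∀ x, F (T x) = B.vershik (F x) := by
  exact theorem4p4_general hX hA.not_discreteTopology T (hA.escapesCompacts hclopen).1
    (hA.escapesCompacts hclopen).2
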